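/- Let $d\ge 1$ be an integer. For $n\le N=2dK$ ($K$ a nonnegative integer), consider a deck of $N$ cards labelled $1,\dots,N$, where card $j$ has suit $j \bmod 2d\in\mathbb Z/2d\mathbb Z$ (so there are $K$ cards of each of the $2d$ suits). Let $\mu_{n,N}$ be the law on $(\mathbb Z/2d\mathbb Z)^n$ of the suits of the first $n$ cards after a uniformly random permutation of the deck, and let $$d_n(N)=\sum_{\omega\in(\mathbb Z/2d\mathbb Z)^n}\bigl[\mu_{n,N}(\omega)-(2d)^{-n}\bigr]^+$$ be its total variation distance to the uniform law on $(\mathbb Z/2d\mathbb Z)^n$, that is, to the law of $n$ i.i.d. uniform suits. (i) For all $n\le N=2dK$, $d_n(N)$ equals the total variation distance between the multivariate hypergeometric law of $n$ draws without replacement from a population with $K$ individuals of each of $2d$ types, with mass $\prod_{i=1}^{2d}\binom{K}{\lambda_i}\big/\binom{N}{n}$ at $\lambda$, and the multinomial law with $n$ trials and probabilities $1/(2d)$, with mass $\frac{n!}{\lambda_1!\cdots\lambda_{2d}!}(2d)^{-n}$ at $\lambda$ (here $\lambda\in\mathbb Z_{\ge 0}^{2d}$, $\lambda_1+\dots+\lambda_{2d}=n$).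 (ii) Let $c\ge 2d$ be a real number, $r=\sqrt{(4d^2-2d)(c-1)\log\frac{c}{c-1}}$, $B_r^{2d}=\{X\in\mathbb R^{2d}:\|X\|\le r\}$ (Euclidean norm), $\varPi_{2d}=\{x\in\mathbb R^{2d}:x_1+\dots+x_{2d}=0\}$, and $$\mathcal G(X)=\pi^{1/2-d}\,2^{3/2-2d}\,d^{1-d}\left[\left(\frac{c}{c-1}\right)^{d-1/2}\exp\left(-\frac{c\|X\|^2}{4d(c-1)}\right)-\exp\left(-\frac{\|X\|^2}{4d}\right)\right].$$ Then $0\le\mathcal G\le 1$ on $B_r^{2d}\cap\varPi_{2d}$, $\mathcal G$ is integrable there, and, as $n\to\infty$ along the integers $n$ for which $cn$ is an integer multiple of $2d$, $$d_n(cn)=\int_{B_r^{2d}\cap\varPi_{2d}}\mathcal G(X)\,dX+\mathcal O\left(\frac1{\sqrt n}\right),$$ where $dX=dx_1\cdots dx_{2d-1}$ is Lebesgue measure in the first $2d-1$ coordinates on the hyperplane $\varPi_{2d}$ (equivalently, the surface measure of $\varPi_{2d}$ divided by $\sqrt{2d}$), and the implied constant may depend on $d$ and $c$. -/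

import Mathlib

open MeasureTheory

noncomputable section

namespace CardDeck

/-- Total variation distance of two probability mass functions `p`, `q` on a discrete space:
the sum of the positive parts of `p x - q x`. -/
def tvDist {α : Type*} (p q : α → ℝ) : ℝ := ∑' x, max (p x - q x) 0

/-- The suit of the card with label `k` in a deck with `2d` suits: the class of `k` modulo `2d`. -/
def suit (d k : ℕ) : ZMod (2 * d) := (k : ZMod (2 * d))

/-- The suits of the first `n` cards of the deck `{1, …, N}` arranged according to the
permutation `σ`. The element `j` of `Fin N` stands for the card with label `j + 1`. -/
def firstSuits (d n N : ℕ) (h : n ≤ N) (σ : Equiv.Perm (Fin N)) : Fin n → ZMod (2 * d) :=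
  fun j => suit d ((σ (Fin.castLE h j) : ℕ) + 1)

/-- Law of the suits of the first `n` cards of a uniformly shuffled deck of `N` cards. -/
def deckLaw (d n N : ℕ) (h : n ≤ N) : PMF (Fin n → ZMod (2 * d)) :=
  (PMF.uniformOfFintype (Equiv.Perm (Fin N))).map (firstSuits d n N h)

/-- Law of `n` independent uniform suits: the uniform law on `(ℤ/2dℤ)^n`. -/
def iidLaw (d n : ℕ) [NeZero d] : PMF (Fin n → ZMod (2 * d)) :=
  PMF.uniformOfFintype (Fin n → ZMod (2 * d))

/-- The distance `d_n(N)` between the suits of the first `n` cards of a shuffled deck of `N` cards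
and `n` independent uniform suits. -/
def deckDist (d n N : ℕ) [NeZero d] (h : n ≤ N) : ℝ :=
  tvDist (fun ω => (deckLaw d n N h ω).toReal) (fun ω => (iidLaw d n ω).toReal)

/-- Mass function of the multivariate hypergeometric law: `n` draws without replacement from a
population that has `K i` individuals of type `i`. -/
def hypergeometricMass {ι : Type*} [Fintype ι] (K : ι → ℕ) (n : ℕ) (l : ι → ℕ) : ℝ :=
  if ∑ i, l i = n then (∏ i, ((K i).choose (l i) : ℝ)) / ((∑ i, K i).choose n : ℝ) else 0

/-- Mass function of the multinomial law: `n` trials with probabilities `p i`. -/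
def multinomialMass {ι : Type*} [Fintype ι] (p : ι → ℝ) (n : ℕ) (l : ι → ℕ) : ℝ :=
  if ∑ i, l i = n then (Nat.multinomial Finset.univ l : ℝ) * ∏ i, p i ^ l i else 0

/-- The hyperplane of vectors of `ℝ^m` with coordinate sum zero. -/
def hyperplane (m : ℕ) : Set (EuclideanSpace ℝ (Fin m)) := {x | ∑ i, x i = 0}

/-- The point `(y₁, …, y_{m-1}, -(y₁ + … + y_{m-1}))` of the hyperplane. -/
def hyperplanePoint (m : ℕ) (y : Fin (m - 1) → ℝ) : EuclideanSpace ℝ (Fin m) :=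
  WithLp.toLp 2 fun i => if h : (i : ℕ) < m - 1 then y ⟨i, h⟩ else -∑ j, y j

/-- The measure `dX = dx₁ ⋯ dx_{m-1}` on the hyperplane: Lebesgue measure in the first `m - 1`
coordinates (the surface measure of the hyperplane divided by `√m`). -/
def hyperplaneMeasure (m : ℕ) : Measure (EuclideanSpace ℝ (Fin m)) :=
  Measure.map (hyperplanePoint m) volume

/-- The radius `r(c)`. -/
def radius (d : ℕ) (c : ℝ) : ℝ :=
  Real.sqrt ((4 * (d : ℝ) ^ 2 - 2 * d) * (c - 1) * Real.log (c / (c - 1)))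

/-- The intersection of the hyperplane with the closed ball of radius `r(c)` in `ℝ^{2d}`. -/
def region (d : ℕ) (c : ℝ) : Set (EuclideanSpace ℝ (Fin (2 * d))) :=
  Metric.closedBall 0 (radius d c) ∩ hyperplane (2 * d)

/-- The Gaussian profile. -/
def profile (d : ℕ) (c : ℝ) (X : EuclideanSpace ℝ (Fin (2 * d))) : ℝ :=
  (Real.pi ^ (1 / 2 - (d : ℝ)) * (2 : ℝ) ^ (3 / 2 - 2 * (d : ℝ)) * (d : ℝ) ^ (1 - (d : ℝ))) *
    ((c / (c - 1)) ^ ((d : ℝ) - 1 / 2) * Real.exp (-(c * ‖X‖ ^ 2) / (4 * d * (c - 1))) -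
      Real.exp (-‖X‖ ^ 2 / (4 * d)))

end CardDeck

end

/-! The probability of a suit word depends only on its suit counts λ, under the deck law as under
the uniform law. Grouping words by λ therefore multiplies both masses by the same multinomial
coefficient, which gives (i): `deckDist_eq_tvDist`, resting on `deckLaw_toReal` and
`card_fun_count_eq_multinomial`.

For (ii), put m = 2d and mK = cn, and rescale λ to the points (m/√n)(λ_i - n/m) of the hyperplane.
In its first m - 1 coordinates these form a lattice with cells of volume (m/√n)^(m-1). While all
deviations λ_i - n/m are O(√n), a second order Stirling expansion of every factorial shows that both
masses, divided by the cell volume, are within O(1/√n) of Gaussian densities; the linear terms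
cancel because the deviations sum to zero (`exists_local_limit`).

Farther out no tail probability has to be estimated. The hypergeometric to multinomial ratio is a
constant times ∏ 1/(K - λ_i)!, and the convexity of log k! forces it below 1 once some deviation
exceeds a fixed multiple of √n, so such λ contribute nothing to the positive part
(`hypergeometricMass_le_multinomialMass`).

The distance is thus the integral of a step function supported in a fixed cube and uniformly
O(1/√n)-close to the positive part of the difference of the two densities
(`exists_abs_stepFunction_sub_le`). The hypergeometric Gaussian is the narrower one and dominates
exactly in the ball of radius r, where the difference is 𝒢 (`setIntegral_profile_region`). -/

namespace CardDeck

/-! ### Counting: from suit words to suit counts. -/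

/-- Injections compatible with two colourings are families of injections between colour classes. -/
def colourEmbeddingEquiv {α β ι : Type*} (col : β → ι) (ω : α → ι) :
    {e : α ↪ β // ∀ a, col (e a) = ω a} ≃
      ∀ s : ι, ({a // ω a = s} ↪ {b // col b = s}) where
  toFun e s := ⟨fun a => ⟨e.1 a.1, (e.2 a.1).trans a.2⟩, fun a a' h => by
    have := congrArg Subtype.val h
    exact Subtype.ext (e.1.injective this)⟩
  invFun F := ⟨⟨fun a => (F (ω a) ⟨a, rfl⟩).1, fun a a' h => by
    have key : ∀ (s s' : ι) (x : {a // ω a = s}) (x' : {a // ω a = s'}), s = s' →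
        (F s x).1 = (F s' x').1 → x.1 = x'.1 := by
      rintro s _ x x' rfl hx
      exact congrArg Subtype.val ((F s).injective (Subtype.ext hx))
    have hs : ω a = ω a' := by
      rw [← (F (ω a) ⟨a, rfl⟩).2, ← (F (ω a') ⟨a', rfl⟩).2]
      exact congrArg col h
    exact key _ _ ⟨a, rfl⟩ ⟨a', rfl⟩ hs h⟩, fun a => (F (ω a) ⟨a, rfl⟩).2⟩
  left_inv e := by ext a; rfl
  right_inv F := by
    funext s
    ext ⟨a, ha⟩
    subst ha
    rfl

lemma card_colourEmbedding {α β ι : Type*} [Fintype α] [Fintype β] [Fintype ι] [DecidableEq ι]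
    [DecidableEq α] [DecidableEq β] (col : β → ι) (ω : α → ι) :
    Fintype.card {e : α ↪ β // ∀ a, col (e a) = ω a} =
      ∏ s : ι, (Fintype.card {b // col b = s}).descFactorial (Fintype.card {a // ω a = s}) := by
  rw [Fintype.card_congr (colourEmbeddingEquiv col ω), Fintype.card_pi]
  exact Finset.prod_congr rfl fun s _ => Fintype.card_embedding_eq

/-- Some permutation τ carries e to e', and left multiplication by τ matches the two fibres. -/
lemma card_perm_extending {α β : Type*} [Fintype α] [Fintype β] [DecidableEq α] [DecidableEq β]
    (i e e' : α ↪ β) :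
    Fintype.card {σ : Equiv.Perm β // i.trans σ.toEmbedding = e} =
      Fintype.card {σ : Equiv.Perm β // i.trans σ.toEmbedding = e'} := by
  obtain ⟨τ, hτ⟩ := Equiv.Perm.exists_extending_pair e e' e.injective e'.injective
  refine Fintype.card_congr ((Equiv.mulLeft τ).subtypeEquiv fun σ => ?_)
  have hτ' : ∀ a, τ (e a) = e' a := fun a => by
    exact hτ a
  constructor
  · rintro h
    ext a
    have := DFunLike.congr_fun h a
    simp at this
    simp [this, hτ']
  · intro h
    ext a
    have := DFunLike.congr_fun h a
    simp [← hτ'] at this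
    simpa using this

/-- A uniform permutation restricts to a uniform injection: all fibres of the restriction have the
same size. That size is never computed; it is eliminated by comparing P with the always true
predicate. -/
lemma card_perm_mul_descFactorial {α β : Type*} [Fintype α] [Fintype β] [DecidableEq α]
    [DecidableEq β] (i : α ↪ β) (P : (α ↪ β) → Prop) [DecidablePred P] :
    Fintype.card {σ : Equiv.Perm β // P (i.trans σ.toEmbedding)} *
      (Fintype.card β).descFactorial (Fintype.card α) =
      (Fintype.card β).factorial * Fintype.card {e : α ↪ β // P e} := by
  have main : ∀ (Q : (α ↪ β) → Prop) [DecidablePred Q],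
      Fintype.card {σ : Equiv.Perm β // Q (i.trans σ.toEmbedding)} =
        Fintype.card {e : α ↪ β // Q e} *
          Fintype.card {σ : Equiv.Perm β // i.trans σ.toEmbedding = i} := by
    intro Q _
    rw [Fintype.card_subtype, Finset.card_eq_sum_card_fiberwise
      (f := fun σ : Equiv.Perm β => i.trans σ.toEmbedding) (t := Finset.univ.filter Q)
      (by intro σ hσ; simpa using hσ)]
    rw [Fintype.card_subtype, ← smul_eq_mul, ← Finset.sum_const]
    refine Finset.sum_congr rfl fun e he => ?_
    rw [card_perm_extending i i e, Fintype.card_subtype, Finset.filter_filter]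
    congr 1
    ext σ
    simp only [Finset.mem_filter, Finset.mem_univ, true_and] at he ⊢
    constructor
    · exact fun h => h.2
    · exact fun h => ⟨h ▸ he, h⟩
  have h1 := main P
  have h2 := main (fun _ => True)
  simp only [Fintype.card_subtype_true, Fintype.card_perm] at h2
  rw [h1, h2, Fintype.card_embedding_eq]
  ring

lemma card_suit_eq (d K : ℕ) [NeZero d] (s : ZMod (2 * d)) :
    Fintype.card {x : Fin (2 * d * K) // suit d ((x : ℕ) + 1) = s} = K := by
  have hd : 0 < 2 * d := by have := NeZero.pos d; omega
  let e : Fin K × Fin (2 * d) ≃ Fin (2 * d * K) :=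
    finProdFinEquiv.trans (finCongr (Nat.mul_comm _ _))
  have : NeZero (2 * d) := ⟨hd.ne'⟩
  have he : ∀ x : Fin K × Fin (2 * d), suit d ((e x : ℕ) + 1) = ((x.2 : ℕ) : ZMod (2 * d)) + 1 := by
    intro x
    simp only [suit, e, Equiv.trans_apply, finCongr_apply, Fin.val_cast, finProdFinEquiv_apply_val]
    push_cast
    have : ((2 : ZMod (2 * d)) * d) = 0 := by exact_mod_cast ZMod.natCast_self (2 * d)
    rw [this]; ring
  rw [← Fintype.card_congr (e.subtypeEquiv (p := fun x => ((x.2 : ℕ) : ZMod (2 * d)) + 1 = s)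
    (fun x => by rw [he]))]
  have : ∀ y : Fin (2 * d), ((y : ℕ) : ZMod (2 * d)) + 1 = s ↔
      y = ⟨(s - 1).val, ZMod.val_lt _⟩ := by
    intro y
    rw [← eq_sub_iff_add_eq]
    constructor
    · intro h
      ext
      simp only [← h]
      rw [ZMod.val_natCast_of_lt y.2]
    · rintro rfl
      simp
  rw [Fintype.card_congr ((Equiv.refl _).subtypeEquiv (q := fun x : Fin K × Fin (2 * d) =>
    x.2 = ⟨(s - 1).val, ZMod.val_lt _⟩) (fun x => this x.2)), Fintype.card_subtype]
  have : (Finset.univ.filter fun x : Fin K × Fin (2 * d) =>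
      x.2 = ⟨(s - 1).val, ZMod.val_lt _⟩) =
      Finset.univ ×ˢ {⟨(s - 1).val, ZMod.val_lt _⟩} := by
    ext x; simp [Prod.ext_iff, eq_comm]
  rw [this]; simp

/-- The first n positions carry a uniform injection, and an injection realising ω splits into
independent injections, one for each suit. -/
lemma deckLaw_toReal (d n K : ℕ) [NeZero d] (h : n ≤ 2 * d * K) (ω : Fin n → ZMod (2 * d)) :
    haveI : NeZero (2 * d) := ⟨by have := NeZero.ne d; omega⟩
    (deckLaw d n (2 * d * K) h ω).toReal =
      (∏ s : ZMod (2 * d), (K.descFactorial (Fintype.card {j // ω j = s}) : ℝ)) /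
        ((2 * d * K).descFactorial n : ℝ) := by
  have : NeZero (2 * d) := ⟨by have := NeZero.ne d; omega⟩
  have h1 := card_perm_mul_descFactorial (Fin.castLEEmb h)
    (fun e => ∀ a, suit d ((e a : ℕ) + 1) = ω a)
  have h2 := card_colourEmbedding (fun x : Fin (2 * d * K) => suit d ((x : ℕ) + 1)) ω
  simp only [card_suit_eq] at h2
  simp only [Fintype.card_fin] at h1
  have h1' : Fintype.card {σ : Equiv.Perm (Fin (2 * d * K)) // ∀ a : Fin n,
      suit d ((((Fin.castLEEmb h).trans σ.toEmbedding) a : ℕ) + 1) = ω a} *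
      (2 * d * K).descFactorial n = (2 * d * K).factorial *
        ∏ s : ZMod (2 * d), K.descFactorial (Fintype.card {j // ω j = s}) := by
    rw [← h2]; convert h1
  have h3 : deckLaw d n (2 * d * K) h ω =
      (Fintype.card {σ : Equiv.Perm (Fin (2 * d * K)) // ∀ a : Fin n,
        suit d ((((Fin.castLEEmb h).trans σ.toEmbedding) a : ℕ) + 1) = ω a} : ENNReal) *
        ((2 * d * K).factorial : ENNReal)⁻¹ := by
    rw [deckLaw, PMF.map_apply, tsum_fintype]
    simp only [PMF.uniformOfFintype_apply, Fintype.card_perm, Fintype.card_fin]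
    rw [← Finset.sum_filter, Finset.sum_const, nsmul_eq_mul, Fintype.card_subtype]
    congr 3
    ext σ
    simp [firstSuits, funext_iff, eq_comm]
  rw [h3, ENNReal.toReal_mul, ENNReal.toReal_inv, ENNReal.toReal_natCast, ENNReal.toReal_natCast]
  have h4 : ((2 * d * K).descFactorial n : ℝ) ≠ 0 := by
    exact_mod_cast (Nat.descFactorial_pos.2 h).ne'
  have h5 : ((2 * d * K).factorial : ℝ) ≠ 0 := by positivity
  rw [eq_div_iff h4]
  field_simp
  exact_mod_cast h1'

/-- Both sides are the coefficient of the monomial with exponent `l` in (∑ X_i)^n, expanded once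
over words and once by the multinomial theorem. -/
lemma card_fun_count_eq_multinomial {ι : Type*} [Fintype ι] [DecidableEq ι] (n : ℕ) (l : ι → ℕ)
    (hl : ∑ i, l i = n) :
    Nat.card {ω : Fin n → ι // ∀ i, Fintype.card {j // ω j = i} = l i} =
      Nat.multinomial Finset.univ l := by
  have h1 := Finset.sum_pow_eq_sum_piAntidiag (Finset.univ : Finset ι)
    (fun i => (MvPolynomial.X i : MvPolynomial ι ℤ)) n
  rw [Fintype.sum_pow] at h1
  have hm : ∀ k : ι → ℕ, (∏ i, (MvPolynomial.X i : MvPolynomial ι ℤ) ^ k i) =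
      MvPolynomial.monomial (Finsupp.equivFunOnFinite.symm k) 1 := by
    intro k
    rw [MvPolynomial.monomial_eq]
    simp [Finsupp.prod_fintype]
  have hω : ∀ ω : Fin n → ι, (∏ j, (MvPolynomial.X (ω j) : MvPolynomial ι ℤ)) =
      MvPolynomial.monomial
        (Finsupp.equivFunOnFinite.symm fun i => Fintype.card {j // ω j = i}) 1 := by
    intro ω
    rw [← hm, ← Finset.prod_fiberwise (s := Finset.univ) (g := ω)]
    refine Finset.prod_congr rfl fun i _ => ?_
    rw [Fintype.card_subtype]
    refine Finset.prod_eq_pow_card fun j hj => ?_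
    rw [(Finset.mem_filter.1 hj).2]
  simp only [hω, hm] at h1
  have h2 := congrArg (MvPolynomial.coeff (Finsupp.equivFunOnFinite.symm l)) h1
  simp only [MvPolynomial.coeff_sum, ← MvPolynomial.C_eq_coe_nat, MvPolynomial.coeff_C_mul,
    MvPolynomial.coeff_monomial, EmbeddingLike.apply_eq_iff_eq] at h2
  rw [Nat.card_eq_fintype_card, Fintype.card_subtype]
  rw [Finset.sum_boole] at h2
  simp only [mul_ite, mul_one, mul_zero] at h2
  rw [Finset.sum_ite_eq' , if_pos (by simp [hl])] at h2
  simp only [funext_iff] at h2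
  exact_mod_cast h2

lemma hypergeometricMass_eq {m : ℕ} (n K : ℕ) (l : Fin m → ℕ) (hl : ∑ i, l i = n) :
    hypergeometricMass (fun _ : Fin m => K) n l =
      (Nat.multinomial Finset.univ l : ℝ) *
        ((∏ i, (K.descFactorial (l i) : ℝ)) / ((m * K).descFactorial n : ℝ)) := by
  have h1 : ((∏ i, ((l i).factorial : ℝ))) * (Nat.multinomial Finset.univ l : ℝ) =
      (n.factorial : ℝ) := by
    rw [← hl]; exact_mod_cast Nat.multinomial_spec Finset.univ l
  simp only [hypergeometricMass, hl, if_true, Finset.sum_const, Finset.card_univ, Fintype.card_fin,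
    smul_eq_mul, Nat.descFactorial_eq_factorial_mul_choose, Nat.cast_mul, Finset.prod_mul_distrib]
  have h2 : (n.factorial : ℝ) ≠ 0 := by positivity
  rw [← mul_div_assoc, ← mul_assoc, mul_comm (Nat.multinomial _ _ : ℝ), h1,
    mul_div_mul_left _ _ h2]

lemma multinomialMass_eq {m : ℕ} (n : ℕ) (l : Fin m → ℕ) (p : ℝ) (hl : ∑ i, l i = n) :
    multinomialMass (fun _ : Fin m => p) n l = (Nat.multinomial Finset.univ l : ℝ) * p ^ n := by
  simp [multinomialMass, hl, Finset.prod_pow_eq_pow_sum]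

lemma tvDist_hypergeometric_multinomial_eq_sum {m : ℕ} (n K : ℕ) (p : ℝ) :
    tvDist (hypergeometricMass (fun _ : Fin m => K) n) (multinomialMass (fun _ : Fin m => p) n) =
      ∑ l ∈ Finset.piAntidiag (Finset.univ : Finset (Fin m)) n,
        max (hypergeometricMass (fun _ : Fin m => K) n l -
          multinomialMass (fun _ : Fin m => p) n l) 0 := by
  rw [tvDist, tsum_eq_sum]
  intro l hl
  have : ¬ ∑ i, l i = n := by simpa using hl
  simp [hypergeometricMass, multinomialMass, this]

theorem deckDist_eq_tvDist (d n K : ℕ) [NeZero d] (h : n ≤ 2 * d * K) :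
    deckDist d n (2 * d * K) h =
      tvDist (hypergeometricMass (fun _ : Fin (2 * d) => K) n)
        (multinomialMass (fun _ : Fin (2 * d) => 1 / (2 * (d : ℝ))) n) := by
  have : NeZero (2 * d) := ⟨by have := NeZero.ne d; omega⟩
  rw [tvDist_hypergeometric_multinomial_eq_sum, deckDist, tvDist, tsum_fintype]
  -- Any bijection serves, since both laws treat all suits alike.
  let e : Fin (2 * d) ≃ ZMod (2 * d) := Fintype.equivOfCardEq (by simp [ZMod.card])
  let cnt : (Fin n → ZMod (2 * d)) → Fin (2 * d) → ℕ := fun ω i => Fintype.card {j // ω j = e i}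
  rw [← Finset.sum_fiberwise_of_maps_to (g := cnt)
    (t := Finset.piAntidiag (Finset.univ : Finset (Fin (2 * d))) n)]
  · refine Finset.sum_congr rfl fun l hl => ?_
    have hl' : ∑ i, l i = n := by simpa using hl
    rw [hypergeometricMass_eq n K l hl', multinomialMass_eq n l _ hl', ← mul_sub,
      ← mul_zero (Nat.multinomial Finset.univ l : ℝ), ← mul_max_of_nonneg _ _ (Nat.cast_nonneg _),
      mul_zero]
    have hcard : Nat.multinomial Finset.univ l =
        (Finset.univ.filter fun ω : Fin n → ZMod (2 * d) => cnt ω = l).card := by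
      rw [← Fintype.card_subtype, ← card_fun_count_eq_multinomial n l hl',
        ← Nat.card_eq_fintype_card]
      refine Nat.card_congr (((Equiv.refl (Fin n)).arrowCongr e).subtypeEquiv fun ω => ?_)
      simp [cnt, funext_iff]
    rw [hcard, ← nsmul_eq_mul, ← Finset.sum_const]
    refine Finset.sum_congr rfl fun ω hω => ?_
    have hω' : cnt ω = l := (Finset.mem_filter.1 hω).2
    rw [deckLaw_toReal, ← e.prod_comp]
    have : ∀ i, Fintype.card {j // ω j = e i} = l i := fun i => congrFun hω' i
    simp only [this]
    congr 2
    simp only [iidLaw, PMF.uniformOfFintype_apply, Fintype.card_fun, ZMod.card, Fintype.card_fin]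
    simp [← inv_pow, mul_comm]
  · intro ω _
    simp only [Finset.mem_piAntidiag, Finset.mem_univ, implies_true, and_true, cnt]
    rw [e.sum_comp (fun s => Fintype.card {j // ω j = s})]
    have := Finset.card_eq_sum_card_fiberwise (f := ω) (s := Finset.univ) (t := Finset.univ)
      (by simp)
    simp only [Finset.card_univ, Fintype.card_fin] at this
    refine Eq.trans ?_ this.symm
    refine Finset.sum_congr rfl fun s _ => ?_
    rw [Fintype.card_subtype]

/-! ### Stirling estimates and quadratic bounds for log k!. -/

/-- The main term `z log z - z + log (2πz) / 2` of Stirling's approximation to `log z!`. -/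
noncomputable def stirlingMain (z : ℝ) : ℝ :=
  z * Real.log z - z + Real.log (2 * Real.pi * z) / 2

lemma stirlingMain_le_log_factorial {k : ℕ} (hk : 0 < k) :
    stirlingMain k ≤ Real.log k.factorial := by
  have h := Stirling.le_log_factorial_stirling hk.ne'
  have h1 : Real.log (2 * Real.pi * k) = Real.log (2 * Real.pi) + Real.log k :=
    Real.log_mul (by positivity) (by positivity)
  rw [stirlingMain, h1]
  linarith

/-- The decrements of log `stirlingSeq` are at most 1/(12k(k+1)), which telescopes. Hence log
`stirlingSeq` k - 1/(12k) increases, and it stays below its limit log √π. -/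
lemma log_stirlingSeq_le {k : ℕ} (hk : 0 < k) :
    Real.log (Stirling.stirlingSeq k) ≤ Real.log Real.pi / 2 + 1 / (12 * k) := by
  obtain ⟨j, rfl⟩ := Nat.exists_eq_succ_of_ne_zero hk.ne'
  have hmono : Monotone fun i : ℕ =>
      Real.log (Stirling.stirlingSeq (i + 1)) - 1 / (12 * ((i : ℝ) + 1)) := by
    refine monotone_nat_of_le_succ fun i => ?_
    have h := Stirling.log_stirlingSeq_sdiff_le (i + 1)
    have h2 : (1 : ℝ) / (12 * ((i + 1 : ℕ) : ℝ) * (((i + 1 : ℕ) : ℝ) + 1)) =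
        1 / (12 * ((i : ℝ) + 1)) - 1 / (12 * (((i + 1 : ℕ) : ℝ) + 1)) := by
      push_cast
      field_simp
      ring
    rw [h2] at h
    linarith
  have hlim : Filter.Tendsto (fun i : ℕ =>
      Real.log (Stirling.stirlingSeq (i + 1)) - 1 / (12 * ((i : ℝ) + 1))) Filter.atTop
      (nhds (Real.log (Real.sqrt Real.pi) - 0)) := by
    refine Filter.Tendsto.sub ?_ ?_
    · refine Filter.Tendsto.log ?_ (by positivity)
      exact Stirling.tendsto_stirlingSeq_sqrt_pi.comp (Filter.tendsto_add_atTop_nat 1)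
    · have := (tendsto_one_div_add_atTop_nhds_zero_nat (𝕜 := ℝ)).const_mul (1 / 12)
      simp only [mul_zero] at this
      refine this.congr fun i => ?_
      field_simp
  have h := hmono.ge_of_tendsto hlim j
  rw [Real.log_sqrt Real.pi_pos.le, sub_zero] at h
  simp only [Nat.succ_eq_add_one] at *
  push_cast
  linarith

lemma abs_log_factorial_sub_stirlingMain_le {k : ℕ} (hk : 0 < k) :
    |Real.log k.factorial - stirlingMain k| ≤ 1 / k := by
  have h0 := stirlingMain_le_log_factorial hk
  have h := log_stirlingSeq_le hk
  have hk' : (0 : ℝ) < k := by exact_mod_cast hk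
  rw [Stirling.log_stirlingSeq_formula, Real.log_mul (by norm_num) hk'.ne',
    Real.log_div hk'.ne' (Real.exp_pos 1).ne', Real.log_exp] at h
  rw [abs_of_nonneg (by linarith)]
  have h1 : Real.log (2 * Real.pi * k) = Real.log 2 + Real.log Real.pi + Real.log k := by
    rw [Real.log_mul (by positivity) hk'.ne', Real.log_mul (by norm_num) (by positivity)]
  have h2 : (1 : ℝ) / (12 * k) ≤ 1 / k := by
    gcongr; linarith
  rw [stirlingMain, h1]
  linarith

lemma abs_log_one_add_le {u : ℝ} (hu : |u| ≤ 1 / 2) : |Real.log (1 + u)| ≤ 2 * |u| := by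
  have h := Real.abs_log_sub_add_sum_range_le (x := -u) (by rw [abs_neg]; linarith) 0
  simp only [Finset.range_zero, Finset.sum_empty, zero_add, sub_neg_eq_add, abs_neg, pow_one] at h
  refine h.trans ?_
  rw [div_le_iff₀ (by linarith)]
  nlinarith [abs_nonneg u]

lemma abs_one_add_mul_log_one_add_sub_le {u : ℝ} (hu : |u| ≤ 1 / 2) :
    |(1 + u) * Real.log (1 + u) - u - u ^ 2 / 2| ≤ 4 * |u| ^ 3 := by
  have h := Real.abs_log_sub_add_sum_range_le (x := -u) (by rw [abs_neg]; linarith) 2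
  simp only [Finset.sum_range_succ, Finset.range_zero, Finset.sum_empty, zero_add, sub_neg_eq_add,
    abs_neg] at h
  norm_num at h
  have h0 := abs_nonneg u
  have h3 : |u| ^ 3 / (1 - |u|) ≤ 2 * |u| ^ 3 := by
    rw [div_le_iff₀ (by linarith)]
    nlinarith [pow_nonneg h0 3]
  have h4 := h.trans h3
  set E := -u + u ^ 2 / 2 + Real.log (1 + u) with hE
  have h5 : (1 + u) * Real.log (1 + u) - u - u ^ 2 / 2 = (1 + u) * E - u ^ 3 / 2 := by
    rw [hE]; ring
  rw [h5]
  calc |(1 + u) * E - u ^ 3 / 2| ≤ |(1 + u) * E| + |u ^ 3 / 2| := abs_sub _ _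
    _ = |1 + u| * |E| + |u| ^ 3 / 2 := by rw [abs_mul, abs_div, abs_pow, abs_two]
    _ ≤ (3 / 2) * (2 * |u| ^ 3) + |u| ^ 3 / 2 := by
        gcongr
        have := abs_add_le 1 u
        rw [abs_one] at this
        linarith
    _ ≤ 4 * |u| ^ 3 := by nlinarith [pow_nonneg h0 3]

/-- Second order expansion of `log k!` around a real point `a` at distance `O(√a)` from `k`. -/
lemma abs_log_factorial_sub_taylor_le {R a : ℝ} {k : ℕ} (ha : 1 ≤ a)
    (haR : 4 * R ^ 2 ≤ a) (hk : |(k : ℝ) - a| ≤ R * Real.sqrt a) :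
    |Real.log k.factorial -
      (stirlingMain a + (k - a) * Real.log a + (k - a) ^ 2 / (2 * a))| ≤
      (2 + R + 4 * R ^ 3) / Real.sqrt a := by
  set s := Real.sqrt a with hs
  have hs1 : 1 ≤ s := Real.one_le_sqrt.2 ha
  have hs2 : s ^ 2 = a := Real.sq_sqrt (by linarith)
  -- This keeps the relative deviation `u` within 1/2, where the logarithmic expansions apply.
  have h2R : 2 * R ≤ s := Real.le_sqrt_of_sq_le (by nlinarith)
  set u := ((k : ℝ) - a) / a with hu
  have ha0 : 0 < a := by linarith
  have hka : (k : ℝ) = a * (1 + u) := by rw [hu]; field_simp; ring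
  have hus : |u| ≤ R / s := by
    rw [hu, abs_div, abs_of_pos ha0, div_le_div_iff₀ ha0 (by linarith)]
    calc |(k : ℝ) - a| * s ≤ R * s * s := by gcongr
      _ = R * a := by rw [← hs2]; ring
  have huh : |u| ≤ 1 / 2 := hus.trans (by rw [div_le_div_iff₀ (by linarith) (by norm_num)]; linarith)
  have hu1 := abs_le.1 huh
  have hk0 : (0 : ℝ) < k := by rw [hka]; apply mul_pos ha0; linarith
  have hk0' : 0 < k := by exact_mod_cast hk0
  have hst := abs_log_factorial_sub_stirlingMain_le hk0'
  have hlogk : Real.log k = Real.log a + Real.log (1 + u) := by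
    rw [hka, Real.log_mul ha0.ne' (by linarith)]
  have hlogp : ∀ z : ℝ, 0 < z → Real.log (2 * Real.pi * z) = Real.log (2 * Real.pi) + Real.log z :=
    fun z hz => Real.log_mul (by positivity) hz.ne'
  -- An exact identity: what remains is `a` times a cubic remainder in `u`, plus half a logarithm.
  -- With |u| ≤ R/√a both are O(1/√a).
  have hid : stirlingMain k - (stirlingMain a + (k - a) * Real.log a + (k - a) ^ 2 / (2 * a)) =
      a * ((1 + u) * Real.log (1 + u) - u - u ^ 2 / 2) + Real.log (1 + u) / 2 := by
    rw [stirlingMain, stirlingMain, hlogp _ hk0, hlogp _ ha0, hlogk, hka]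
    field_simp
    ring
  have h1 : (1 : ℝ) / k ≤ 2 / s := by
    rw [div_le_div_iff₀ hk0 (by linarith), hka]
    nlinarith
  have h2 : |a * ((1 + u) * Real.log (1 + u) - u - u ^ 2 / 2)| ≤ 4 * R ^ 3 / s := by
    rw [abs_mul, abs_of_pos ha0]
    calc a * _ ≤ a * (4 * |u| ^ 3) := by
          gcongr; exact abs_one_add_mul_log_one_add_sub_le huh
      _ ≤ a * (4 * (R / s) ^ 3) := by gcongr
      _ = 4 * R ^ 3 / s := by rw [← hs2]; field_simp
  have h3 : |Real.log (1 + u) / 2| ≤ R / s := by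
    rw [abs_div, abs_two]
    linarith [abs_log_one_add_le huh]
  have hsum : (2 + R + 4 * R ^ 3) / s = 2 / s + (4 * R ^ 3 / s + R / s) := by ring
  rw [hsum]
  calc _ = |(Real.log k.factorial - stirlingMain k) + (stirlingMain k -
        (stirlingMain a + (k - a) * Real.log a + (k - a) ^ 2 / (2 * a)))| := by congr 1; ring
    _ ≤ |Real.log k.factorial - stirlingMain k| + |stirlingMain k -
        (stirlingMain a + (k - a) * Real.log a + (k - a) ^ 2 / (2 * a))| := abs_add_le _ _
    _ ≤ 2 / s + (4 * R ^ 3 / s + R / s) := by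
        rw [hid]
        exact add_le_add (hst.trans h1) ((abs_add_le _ _).trans (add_le_add h2 h3))

lemma log_factorial_succ (k : ℕ) :
    Real.log (k + 1).factorial = Real.log (k + 1 : ℝ) + Real.log k.factorial := by
  rw [Nat.factorial_succ, Nat.cast_mul, Real.log_mul (by positivity) (by positivity)]
  push_cast; rfl

/-- Global quadratic lower bound for `log k!`, from the concavity of the logarithm. -/
lemma log_factorial_ge_quadratic {k a M : ℕ} (ha : 0 < a) (haM : a ≤ M) (hkM : k ≤ M) :
    Real.log a.factorial + ((k : ℝ) - a) * Real.log a + ((k : ℝ) - a) ^ 2 / (2 * M) - 1 / 2 ≤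
      Real.log k.factorial := by
  have ha' : (0 : ℝ) < a := by exact_mod_cast ha
  have hM' : (0 : ℝ) < M := by exact_mod_cast ha.trans_le haM
  rcases le_total a k with h | h
  -- Each factor a + l + 1 exceeds a by at least (l + 1)/M in logarithm, because log x ≤ x - 1;
  -- these gains sum to the quadratic term.
  · have key : ∀ l : ℕ, a + l ≤ M → Real.log a.factorial + (l : ℝ) * Real.log a +
        (l : ℝ) ^ 2 / (2 * M) ≤ Real.log (a + l).factorial := by
      intro l
      induction l with
      | zero => simp
      | succ l ih =>
        intro hl
        have h1 := ih (by omega)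
        have hl' : (a : ℝ) + l + 1 ≤ M := by exact_mod_cast hl
        have h2 : Real.log a + ((l : ℝ) + 1) / M ≤ Real.log (a + l + 1 : ℝ) := by
          have h3 : Real.log a - Real.log (a + l + 1 : ℝ) ≤ (a : ℝ) / (a + l + 1) - 1 := by
            rw [← Real.log_div ha'.ne' (by positivity)]
            exact Real.log_le_sub_one_of_pos (by positivity)
          have h4 : ((l : ℝ) + 1) / M ≤ (l + 1) / (a + l + 1) := by gcongr
          have h5 : (a : ℝ) / (a + l + 1) - 1 = -((l + 1) / (a + l + 1)) := by
            field_simp; ring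
          linarith
        rw [← add_assoc, log_factorial_succ]
        push_cast
        have h6 : ((l : ℝ) + 1) ^ 2 / (2 * M) ≤ (l : ℝ) ^ 2 / (2 * M) + (l + 1) / M := by
          rw [div_add_div _ _ (by positivity) (by positivity), div_le_div_iff₀ (by positivity)
            (by positivity)]
          have : (0 : ℝ) ≤ (M : ℝ) ^ 2 := by positivity
          nlinarith
        linarith
    obtain ⟨l, rfl⟩ := Nat.exists_eq_add_of_le h
    have := key l hkM
    push_cast
    simp only [add_sub_cancel_left]
    linarith
  -- Going down, the gains 0, 1/M, ..., (l - 1)/M sum to l(l - 1)/(2M). The shortfall l/(2M) from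
  -- l²/(2M) is at most 1/2, which accounts for the constant in the statement.
  · have key : ∀ l : ℕ, l ≤ a → Real.log a.factorial - (l : ℝ) * Real.log a +
        (l : ℝ) * (l - 1) / (2 * M) ≤ Real.log (a - l).factorial := by
      intro l
      induction l with
      | zero => simp
      | succ l ih =>
        intro hl
        have h1 := ih (by omega)
        obtain ⟨j, hj⟩ : ∃ j, a = j + l + 1 := ⟨a - l - 1, by omega⟩
        have e1 : a - l = j + 1 := by omega
        have e2 : a - (l + 1) = j := by omega
        rw [e1, log_factorial_succ] at h1
        rw [e2]
        have hjl : (a : ℝ) = j + l + 1 := by exact_mod_cast hj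
        have h2 : Real.log (j + 1 : ℝ) ≤ Real.log a - (l : ℝ) / M := by
          have h3 : Real.log (j + 1 : ℝ) - Real.log a ≤ (j + 1 : ℝ) / a - 1 := by
            rw [← Real.log_div (by positivity) ha'.ne']
            exact Real.log_le_sub_one_of_pos (by positivity)
          have h4 : (l : ℝ) / M ≤ l / a := by
            have : (a : ℝ) ≤ M := by exact_mod_cast haM
            gcongr
          have h5 : (j + 1 : ℝ) / a - 1 = -(l / a) := by
            field_simp; linarith
          linarith
        push_cast
        have h6 : ((l : ℝ) + 1) * (l + 1 - 1) / (2 * M) = (l : ℝ) * (l - 1) / (2 * M) + l / M := by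
          field_simp; ring
        linarith
    obtain ⟨l, rfl⟩ := Nat.exists_eq_add_of_le h
    have h1 := key l (by omega)
    rw [Nat.add_sub_cancel] at h1
    have h2 : (l : ℝ) / (2 * M) ≤ 1 / 2 := by
      rw [div_le_div_iff₀ (by positivity) (by norm_num)]
      have : (l : ℝ) ≤ M := by exact_mod_cast (by omega)
      linarith
    have h3 : (l : ℝ) * (l - 1) / (2 * M) = (l : ℝ) ^ 2 / (2 * M) - l / (2 * M) := by ring
    have h4 : (k : ℝ) - (k + l : ℕ) = -l := by push_cast; ring
    rw [h4, neg_sq]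
    linarith

/-- Brings the factorials without deviation, such as n! and K!, to the error form D/√a of the Taylor
estimates, so that all errors can be added. -/
lemma abs_log_factorial_sub_stirlingMain_le_of_le {D a : ℝ} {k : ℕ} (hD : 1 ≤ D) (ha : 1 ≤ a)
    (hk : a ≤ k) : |Real.log k.factorial - stirlingMain k| ≤ D / Real.sqrt a := by
  have hk0 : (0 : ℝ) < k := by linarith
  refine (abs_log_factorial_sub_stirlingMain_le (by exact_mod_cast hk0)).trans ?_
  have hs : 1 ≤ Real.sqrt a := Real.one_le_sqrt.2 ha
  have hs2 : Real.sqrt a ^ 2 = a := Real.sq_sqrt (by linarith)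
  rw [div_le_div_iff₀ hk0 (by linarith)]
  nlinarith

/-! ### Local limit theorems in the central region. -/

lemma stirlingMain_multinomial {m n : ℝ} (hm : 0 < m) (hn : 0 < n) :
    stirlingMain n - m * stirlingMain (n / m) - n * Real.log m =
      -(m - 1) / 2 * (Real.log (2 * Real.pi) + Real.log n) + m / 2 * Real.log m := by
  have h2 : (2 * Real.pi) ≠ 0 := by positivity
  rw [stirlingMain, stirlingMain, Real.log_mul h2 hn.ne', Real.log_mul h2 (by positivity),
    Real.log_div hn.ne' hm.ne']
  field_simp
  ring

/-- As in `stirlingMain_multinomial`, the terms of order n log n and n cancel and only the half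
logarithms survive. Here their n-dependence cancels too, leaving the factor (c/(c-1))^((m-1)/2)
between the two Gaussians. -/
lemma stirlingMain_shifted_ratio {m n c : ℝ} (hm : 0 < m) (hn : 0 < n) (hc : 1 < c) :
    m * stirlingMain (c * n / m) - m * stirlingMain ((c - 1) * n / m) - stirlingMain (c * n) +
      stirlingMain ((c - 1) * n) + n * Real.log m =
      (m - 1) / 2 * (Real.log c - Real.log (c - 1)) := by
  have h2 : (2 * Real.pi) ≠ 0 := by positivity
  have hc0 : 0 < c := by linarith
  have hc1 : 0 < c - 1 := by linarith
  simp only [stirlingMain]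
  rw [Real.log_mul h2 (by positivity), Real.log_mul h2 (by positivity),
    Real.log_mul h2 (by positivity), Real.log_mul h2 (by positivity),
    Real.log_div (by positivity) hm.ne', Real.log_div (by positivity) hm.ne',
    Real.log_mul hc0.ne' hn.ne', Real.log_mul hc1.ne' hn.ne']
  field_simp
  ring

lemma log_multinomial {m : ℕ} (l : Fin m → ℕ) :
    Real.log (Nat.multinomial Finset.univ l) =
      Real.log (∑ i, l i).factorial - ∑ i, Real.log (l i).factorial := by
  rw [← Nat.multinomial_spec Finset.univ l]
  push_cast
  rw [Real.log_mul (Finset.prod_ne_zero_iff.2 fun i _ => by positivity)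
    (by exact_mod_cast (Nat.multinomial_pos _ _).ne'), Real.log_prod (fun i _ => by positivity)]
  ring

lemma log_descFactorial {N k : ℕ} (h : k ≤ N) :
    Real.log (N.descFactorial k) = Real.log N.factorial - Real.log (N - k).factorial := by
  rw [← Nat.factorial_mul_descFactorial h]
  push_cast
  rw [Real.log_mul (by positivity) (by exact_mod_cast (Nat.descFactorial_pos.2 h).ne')]
  ring

lemma sum_sub_div_eq_zero {m n : ℕ} (hm : 0 < m) (l : Fin m → ℕ) (hl : ∑ i, l i = n) :
    ∑ i, ((l i : ℝ) - n / m) = 0 := by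
  have hl' : ∑ i, (l i : ℝ) = n := by exact_mod_cast hl
  rw [Finset.sum_sub_distrib, hl']
  simp only [Finset.sum_const, Finset.card_univ, Fintype.card_fin, nsmul_eq_mul]
  field_simp
  ring

/-- Sum of the second order expansions of `log (k i)!` when the deviations `δ i` sum to zero. -/
lemma abs_sum_log_factorial_sub_le {m : ℕ} {D a : ℝ} (k : Fin m → ℕ) (δ : Fin m → ℝ)
    (hδ : ∑ i, δ i = 0)
    (h : ∀ i, |Real.log (k i).factorial -
      (stirlingMain a + δ i * Real.log a + δ i ^ 2 / (2 * a))| ≤ D) :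
    |∑ i, Real.log (k i).factorial - (m * stirlingMain a + (∑ i, δ i ^ 2) / (2 * a))| ≤ m * D := by
  have h1 : ∑ i, Real.log (k i).factorial - (m * stirlingMain a + (∑ i, δ i ^ 2) / (2 * a)) =
      ∑ i, (Real.log (k i).factorial -
        (stirlingMain a + δ i * Real.log a + δ i ^ 2 / (2 * a))) := by
    rw [Finset.sum_sub_distrib, Finset.sum_add_distrib, Finset.sum_add_distrib, ← Finset.sum_mul,
      hδ, ← Finset.sum_div]
    simp
  rw [h1]
  refine (Finset.abs_sum_le_sum_abs _ _).trans ((Finset.sum_le_sum fun i _ => h i).trans ?_)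
  simp

/-- Local limit theorem for the multinomial law in the central region. -/
lemma abs_log_multinomialMass_sub_le {m n : ℕ} {R : ℝ} (hm : 0 < m) (hR : 0 ≤ R)
    (ha : 1 ≤ (n / m : ℝ)) (haR : 4 * R ^ 2 ≤ (n / m : ℝ)) (l : Fin m → ℕ) (hl : ∑ i, l i = n)
    (hb : ∀ i, |(l i : ℝ) - n / m| ≤ R * Real.sqrt (n / m)) :
    |Real.log (multinomialMass (fun _ : Fin m => 1 / (m : ℝ)) n l) -
      (-((m : ℝ) - 1) / 2 * (Real.log (2 * Real.pi) + Real.log n) + m / 2 * Real.log m -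
        (∑ i, ((l i : ℝ) - n / m) ^ 2) / (2 * (n / m)))| ≤
      (m + 1) * ((2 + R + 4 * R ^ 3) / Real.sqrt (n / m)) := by
  have hm' : (0 : ℝ) < m := by exact_mod_cast hm
  have hn' : (0 : ℝ) < n := by
    by_contra hcon
    have : (n : ℝ) = 0 := le_antisymm (not_lt.1 hcon) (Nat.cast_nonneg n)
    rw [this] at ha; norm_num at ha
  have hm1 : (1 : ℝ) ≤ m := by exact_mod_cast hm
  have h1 := abs_sum_log_factorial_sub_le l (fun i => (l i : ℝ) - n / m)
    (sum_sub_div_eq_zero hm l hl)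
    (fun i => abs_log_factorial_sub_taylor_le ha haR (hb i))
  have h2 := abs_log_factorial_sub_stirlingMain_le_of_le (D := 2 + R + 4 * R ^ 3)
    (by have := pow_nonneg hR 3; linarith) ha (k := n) (div_le_self hn'.le hm1)
  have h3 := stirlingMain_multinomial hm' hn'
  have h4 : Real.log (multinomialMass (fun _ : Fin m => 1 / (m : ℝ)) n l) =
      Real.log n.factorial - ∑ i, Real.log (l i).factorial - n * Real.log m := by
    rw [multinomialMass_eq n l _ hl, Real.log_mul
      (by exact_mod_cast (Nat.multinomial_pos _ _).ne') (by positivity), log_multinomial, hl,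
      Real.log_pow, Real.log_div one_ne_zero hm'.ne', Real.log_one]
    ring
  rw [h4, ← h3]
  rw [abs_le] at *
  constructor <;> linarith [h1.1, h1.2, h2.1, h2.2]

/-- Local limit theorem for the multivariate hypergeometric law in the central region. -/
lemma abs_log_hypergeometricMass_sub_le {m n K : ℕ} {R c : ℝ} (hm : 0 < m) (hR : 0 ≤ R)
    (hc : 2 ≤ c) (hK : ((m * K : ℕ) : ℝ) = c * n) (hnK : n ≤ K)
    (ha : 1 ≤ (n / m : ℝ)) (haR : 4 * R ^ 2 ≤ (n / m : ℝ)) (l : Fin m → ℕ) (hl : ∑ i, l i = n)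
    (hb : ∀ i, |(l i : ℝ) - n / m| ≤ R * Real.sqrt (n / m)) :
    |Real.log (hypergeometricMass (fun _ : Fin m => K) n l) -
      ((((m : ℝ) - 1) / 2 * (Real.log c - Real.log (c - 1)) +
        (-((m : ℝ) - 1) / 2 * (Real.log (2 * Real.pi) + Real.log n) + m / 2 * Real.log m)) -
        (c / (c - 1)) * ((∑ i, ((l i : ℝ) - n / m) ^ 2) / (2 * (n / m))))| ≤
      (3 * m + 3) * ((2 + R + 4 * R ^ 3) / Real.sqrt (n / m)) := by
  have hm' : (0 : ℝ) < m := by exact_mod_cast hm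
  have hn' : (0 : ℝ) < n := by
    by_contra hcon
    have : (n : ℝ) = 0 := le_antisymm (not_lt.1 hcon) (Nat.cast_nonneg n)
    rw [this] at ha; norm_num at ha
  have hm1 : (1 : ℝ) ≤ m := by exact_mod_cast hm
  have hD : 1 ≤ 2 + R + 4 * R ^ 3 := by have := pow_nonneg hR 3; linarith
  have han : (n / m : ℝ) ≤ n := div_le_self hn'.le hm1
  have hc1 : 0 < c - 1 := by linarith
  have hK' : (K : ℝ) = c * n / m := by
    push_cast at hK; rw [eq_div_iff hm'.ne']; linarith
  have hlK : ∀ i, l i ≤ K := fun i =>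
    ((Finset.single_le_sum (fun j _ => Nat.zero_le (l j)) (Finset.mem_univ i)).trans hl.le).trans
      hnK
  have hnN : n ≤ m * K := hnK.trans (Nat.le_mul_of_pos_left K hm)
  have hab : (n / m : ℝ) ≤ (c - 1) * n / m := by
    gcongr; nlinarith
  have h1 := abs_sum_log_factorial_sub_le l (fun i => (l i : ℝ) - n / m)
    (sum_sub_div_eq_zero hm l hl)
    (fun i => abs_log_factorial_sub_taylor_le ha haR (hb i))
  -- The complement K - l i is centred at (c - 1)n/m with the opposite deviation, so the same
  -- expansion applies to its factorial.
  have hdev : ∀ i, ((K - l i : ℕ) : ℝ) - (c - 1) * n / m = -((l i : ℝ) - n / m) := fun i => by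
    rw [Nat.cast_sub (hlK i), hK']; ring
  have h5 := abs_sum_log_factorial_sub_le (D := (2 + R + 4 * R ^ 3) / Real.sqrt (n / m))
    (a := (c - 1) * n / m) (fun i => K - l i)
    (fun i => -((l i : ℝ) - n / m))
    (by rw [Finset.sum_neg_distrib, sum_sub_div_eq_zero hm l hl, neg_zero])
    (fun i => by
      have := abs_log_factorial_sub_taylor_le (k := K - l i) (ha.trans hab) (haR.trans hab)
        (by
          rw [hdev, abs_neg]
          exact (hb i).trans (by gcongr))
      rw [hdev] at this
      exact this.trans (by gcongr))
  simp only [neg_sq] at h5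
  have h2 := abs_log_factorial_sub_stirlingMain_le_of_le hD ha (k := n) han
  have h6 := abs_log_factorial_sub_stirlingMain_le_of_le hD ha (k := K)
    (han.trans (by exact_mod_cast hnK))
  have h7 := abs_log_factorial_sub_stirlingMain_le_of_le hD ha (k := m * K)
    (han.trans (by exact_mod_cast hnN))
  have hNn : ((m * K - n : ℕ) : ℝ) = (c - 1) * n := by
    rw [Nat.cast_sub hnN, hK]; ring
  have h8 := abs_log_factorial_sub_stirlingMain_le_of_le hD ha (k := m * K - n)
    (by rw [hNn]; nlinarith)
  rw [hNn] at h8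
  rw [hK] at h7
  rw [hK'] at h6
  have h3 := stirlingMain_multinomial hm' hn'
  have h9 := stirlingMain_shifted_ratio hm' hn' (show 1 < c by linarith)
  have h4 : Real.log (hypergeometricMass (fun _ : Fin m => K) n l) =
      Real.log n.factorial - ∑ i, Real.log (l i).factorial +
        (m * Real.log K.factorial - ∑ i, Real.log (K - l i).factorial) -
        (Real.log (m * K).factorial - Real.log (m * K - n).factorial) := by
    have hp : ∀ i, (K.descFactorial (l i) : ℝ) ≠ 0 := fun i => by
      exact_mod_cast (Nat.descFactorial_pos.2 (hlK i)).ne'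
    rw [hypergeometricMass_eq n K l hl, Real.log_mul
      (by exact_mod_cast (Nat.multinomial_pos _ _).ne')
      (div_ne_zero (Finset.prod_ne_zero_iff.2 fun i _ => hp i)
        (by exact_mod_cast (Nat.descFactorial_pos.2 hnN).ne')), log_multinomial, hl,
      Real.log_div (Finset.prod_ne_zero_iff.2 fun i _ => hp i)
        (by exact_mod_cast (Nat.descFactorial_pos.2 hnN).ne'), log_descFactorial hnN,
      Real.log_prod (fun i _ => hp i),
      Finset.sum_congr rfl (fun i _ => log_descFactorial (hlK i)), Finset.sum_sub_distrib]
    simp only [Finset.sum_const, Finset.card_univ, Fintype.card_fin, nsmul_eq_mul]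
    ring
  set S := ∑ i, ((l i : ℝ) - n / m) ^ 2
  -- The quadratic terms of l i and K - l i add up, as 1 + 1/(c - 1) = c/(c - 1).
  have h10 : c / (c - 1) * (S / (2 * (n / m))) =
      S / (2 * (n / m)) + S / (2 * ((c - 1) * n / m)) := by
    field_simp; ring
  rw [h4, ← h3, ← h9, h10]
  set T := (2 + R + 4 * R ^ 3) / Real.sqrt (n / m)
  have h6' : |m * Real.log K.factorial - m * stirlingMain (c * n / m)| ≤ m * T := by
    rw [← mul_sub, abs_mul, abs_of_pos hm']
    gcongr
  -- The 3m + 3 errors come from the m factorials of l i, the m factorials of K - l i, m copies of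
  -- K!, and n!, (mK)!, (mK - n)!.
  rw [abs_le] at *
  constructor <;> linarith [h1.1, h1.2, h2.1, h2.2, h5.1, h5.2, h6'.1, h6'.2, h7.1, h7.2, h8.1,
    h8.2]

/-! ### Domination by the multinomial mass away from the mean. -/

/-- Far from the mean, the hypergeometric mass is at most the multinomial mass. -/
lemma hypergeometricMass_le_multinomialMass {m n K : ℕ} {c : ℝ} (hm : 0 < m)
    (hc : 2 ≤ c) (hK : ((m * K : ℕ) : ℝ) = c * n) (hnK : n ≤ K)
    (ha : 4 ≤ (n / m : ℝ)) (l : Fin m → ℕ) (hl : ∑ i, l i = n) (i₀ : Fin m)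
    (hi : Real.sqrt (24 * c * n) + 1 ≤ |(l i₀ : ℝ) - n / m|) :
    hypergeometricMass (fun _ : Fin m => K) n l ≤
      multinomialMass (fun _ : Fin m => 1 / (m : ℝ)) n l := by
  have hm' : (0 : ℝ) < m := by exact_mod_cast hm
  have hn' : (0 : ℝ) < n := by
    by_contra hcon
    have : (n : ℝ) = 0 := le_antisymm (not_lt.1 hcon) (Nat.cast_nonneg n)
    rw [this] at ha; norm_num at ha
  have hm1 : (1 : ℝ) ≤ m := by exact_mod_cast hm
  have han : (n / m : ℝ) ≤ n := div_le_self hn'.le hm1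
  have hc1 : 0 < c - 1 := by linarith
  have hK' : (K : ℝ) = c * n / m := by
    push_cast at hK; rw [eq_div_iff hm'.ne']; linarith
  have hlK : ∀ i, l i ≤ K := fun i =>
    ((Finset.single_le_sum (fun j _ => Nat.zero_le (l j)) (Finset.mem_univ i)).trans hl.le).trans
      hnK
  have hnN : n ≤ m * K := hnK.trans (Nat.le_mul_of_pos_left K hm)
  have hNn : ((m * K - n : ℕ) : ℝ) = (c - 1) * n := by
    rw [Nat.cast_sub hnN, hK]; ring
  set b : ℝ := (c - 1) * n / m with hbdef
  have hab : (n / m : ℝ) ≤ b := by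
    rw [hbdef]; gcongr; nlinarith
  have hb4 : 4 ≤ b := ha.trans hab
  -- The convexity bound needs an integer base point. Replacing the mean b of K - l i by its floor
  -- costs only bounded errors, and accounts for the + 1 in the deviation hypothesis.
  obtain ⟨a, hadef⟩ : ∃ a, a = ⌊b⌋₊ := ⟨_, rfl⟩
  have ha1 : (a : ℝ) ≤ b := hadef ▸ Nat.floor_le (by linarith)
  have ha2 : b < a + 1 := hadef ▸ Nat.lt_floor_add_one b
  have hapos : (0 : ℝ) < a := by linarith
  have hapos' : 0 < a := by exact_mod_cast hapos
  have hbK : b ≤ K := by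
    rw [hK', hbdef]; gcongr; linarith
  have haK : a ≤ K := by exact_mod_cast ha1.trans hbK
  have hsb : 1 ≤ Real.sqrt b := Real.one_le_sqrt.2 (by linarith)
  have href : stirlingMain b + (a - b) * Real.log b - 7 ≤ Real.log a.factorial := by
    have h := abs_log_factorial_sub_taylor_le (R := 1) (a := b) (k := a)
      (by linarith) (by linarith) (by rw [abs_le]; constructor <;> linarith)
    have h7 : (2 + 1 + 4 * (1 : ℝ) ^ 3) / Real.sqrt b ≤ 7 := by
      rw [div_le_iff₀ (by linarith)]; linarith
    have h8 : 0 ≤ ((a : ℝ) - b) ^ 2 / (2 * b) := by positivity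
    have := (abs_le.1 (h.trans h7)).1
    linarith
  have hlogab : Real.log b - Real.log a ≤ 1 / a := by
    rw [← Real.log_div (by linarith) hapos.ne']
    refine (Real.log_le_sub_one_of_pos (by positivity)).trans ?_
    rw [div_sub_one hapos.ne']
    gcongr; linarith
  -- The deviations from a sum to m(b - a) instead of 0; this bounds what the leftover linear term
  -- can lose.
  have hcross : -1 ≤ (b - a) * (Real.log a - Real.log b) := by
    have h1 : (1 : ℝ) / a ≤ 1 := by rw [div_le_one hapos]; exact_mod_cast hapos'
    have h2 : Real.log a ≤ Real.log b := Real.log_le_log hapos ha1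
    nlinarith
  have hquad : ∀ i, Real.log a.factorial + (((K - l i : ℕ) : ℝ) - a) * Real.log a +
      (((K - l i : ℕ) : ℝ) - a) ^ 2 / (2 * K) - 1 / 2 ≤ Real.log (K - l i).factorial := fun i =>
    log_factorial_ge_quadratic hapos' haK (Nat.sub_le _ _)
  have hKpos : (0 : ℝ) < K := by linarith
  have hsum : ∑ i, (Real.log a.factorial + (((K - l i : ℕ) : ℝ) - a) * Real.log a - 1 / 2) +
      12 * m ≤ ∑ i, Real.log (K - l i).factorial := by
    -- 24cn/(2K) = 12m, whence the constant 24. The gain 12m outweighs the losses 7 (`href`), 1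
    -- (`hcross`), 1/2 (`hquad`) and 1 (`hKfac`) per coordinate, together with 1 (`hNnfac`) and (m -
    -- 1)/2 (`hlogc'`).
    have h1 : (12 * m : ℝ) ≤ (((K - l i₀ : ℕ) : ℝ) - a) ^ 2 / (2 * K) := by
      rw [le_div_iff₀ (by positivity), hK']
      have h2 : Real.sqrt (24 * c * n) ≤ |((K - l i₀ : ℕ) : ℝ) - a| := by
        have h3 : ((K - l i₀ : ℕ) : ℝ) - a = -((l i₀ : ℝ) - n / m) + (b - a) := by
          rw [Nat.cast_sub (hlK i₀), hK', hbdef]; ring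
        have h4 : |(l i₀ : ℝ) - n / m| ≤ |((K - l i₀ : ℕ) : ℝ) - a| + |b - a| := by
          have h5 : (l i₀ : ℝ) - n / m = (b - a) - (((K - l i₀ : ℕ) : ℝ) - a) := by rw [h3]; ring
          rw [h5, add_comm]
          exact abs_sub _ _
        have h6 : |b - a| ≤ 1 := by rw [abs_le]; constructor <;> linarith
        linarith
      have h7 := pow_le_pow_left₀ (Real.sqrt_nonneg _) h2 2
      rw [Real.sq_sqrt (by positivity), sq_abs] at h7
      refine le_trans (le_of_eq ?_) h7
      field_simp
      norm_num
    have h2 : (12 * m : ℝ) ≤ ∑ i, (((K - l i : ℕ) : ℝ) - a) ^ 2 / (2 * K) :=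
      h1.trans (Finset.single_le_sum (f := fun i => (((K - l i : ℕ) : ℝ) - a) ^ 2 / (2 * (K : ℝ)))
        (fun i _ => by positivity) (Finset.mem_univ i₀))
    refine (add_le_add_right h2 _).trans ?_
    rw [← Finset.sum_add_distrib]
    refine Finset.sum_le_sum fun i _ => ?_
    linarith [hquad i]
  have hdevsum : ∑ i, (((K - l i : ℕ) : ℝ) - a) = m * (b - a) := by
    have h1 : ∀ i, ((K - l i : ℕ) : ℝ) - a = -((l i : ℝ) - n / m) + (b - a) := fun i => by
      rw [Nat.cast_sub (hlK i), hK', hbdef]; ring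
    rw [Finset.sum_congr rfl fun i _ => h1 i, Finset.sum_add_distrib, Finset.sum_neg_distrib,
      sum_sub_div_eq_zero hm l hl]
    simp only [neg_zero, zero_add, Finset.sum_const, Finset.card_univ, Fintype.card_fin,
      nsmul_eq_mul]
  rw [Finset.sum_sub_distrib, Finset.sum_add_distrib, ← Finset.sum_mul, hdevsum] at hsum
  simp only [Finset.sum_const, Finset.card_univ, Fintype.card_fin, nsmul_eq_mul] at hsum
  have hKfac : Real.log K.factorial ≤ stirlingMain (c * n / m) + 1 := by
    have h := abs_log_factorial_sub_stirlingMain_le (k := K) (by exact_mod_cast hKpos)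
    have h1 : (1 : ℝ) / K ≤ 1 := by rw [div_le_one hKpos]; linarith
    rw [← hK']
    linarith [(abs_le.1 h).2]
  have hNfac : stirlingMain (c * n) ≤ Real.log (m * K).factorial := by
    rw [← hK]
    exact stirlingMain_le_log_factorial (Nat.mul_pos hm (by exact_mod_cast hKpos))
  have hNnfac : Real.log (m * K - n).factorial ≤ stirlingMain ((c - 1) * n) + 1 := by
    have hpos : (0 : ℝ) < ((m * K - n : ℕ) : ℝ) := by rw [hNn]; positivity
    have h := abs_log_factorial_sub_stirlingMain_le (k := m * K - n) (by exact_mod_cast hpos)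
    have h1 : (1 : ℝ) / ((m * K - n : ℕ) : ℝ) ≤ 1 := by
      rw [div_le_one hpos, hNn]; nlinarith
    rw [← hNn]
    linarith [(abs_le.1 h).2]
  have hratio := stirlingMain_shifted_ratio hm' hn' (show 1 < c by linarith)
  have hlogc : Real.log c - Real.log (c - 1) ≤ 1 := by
    rw [← Real.log_div (by linarith) hc1.ne']
    refine (Real.log_le_sub_one_of_pos (by positivity)).trans ?_
    rw [div_sub_one hc1.ne', div_le_one hc1]; linarith
  have hlogc' : ((m : ℝ) - 1) / 2 * (Real.log c - Real.log (c - 1)) ≤ ((m : ℝ) - 1) / 2 * 1 :=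
    mul_le_mul_of_nonneg_left hlogc (by linarith)
  have hfinal : Real.log (∏ i, (K.descFactorial (l i) : ℝ)) - Real.log ((m * K).descFactorial n) ≤
      -(n * Real.log m) := by
    have hp : ∀ i, (K.descFactorial (l i) : ℝ) ≠ 0 := fun i => by
      exact_mod_cast (Nat.descFactorial_pos.2 (hlK i)).ne'
    rw [log_descFactorial hnN, Real.log_prod (fun i _ => hp i),
      Finset.sum_congr rfl (fun i _ => log_descFactorial (hlK i)), Finset.sum_sub_distrib]
    simp only [Finset.sum_const, Finset.card_univ, Fintype.card_fin, nsmul_eq_mul]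
    have e1 := mul_le_mul_of_nonneg_left hcross hm'.le
    have e2 := mul_le_mul_of_nonneg_left href hm'.le
    have e3 := mul_le_mul_of_nonneg_left hKfac hm'.le
    linarith
  rw [hypergeometricMass_eq n K l hl, multinomialMass_eq n l _ hl]
  refine mul_le_mul_of_nonneg_left ?_ (Nat.cast_nonneg _)
  have hp : 0 < (∏ i, (K.descFactorial (l i) : ℝ)) := Finset.prod_pos fun i _ => by
    exact_mod_cast Nat.descFactorial_pos.2 (hlK i)
  have hq : (0 : ℝ) < (m * K).descFactorial n := by
    exact_mod_cast Nat.descFactorial_pos.2 hnN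
  rw [← Real.log_le_log_iff (by positivity) (by positivity), Real.log_div hp.ne' hq.ne',
    Real.log_pow, Real.log_div one_ne_zero hm'.ne', Real.log_one]
  linarith

/-! ### Gaussian densities and the rescaled local limits. -/

/-- Limiting multinomial density, as a function of the squared norm `q`. -/
noncomputable def multinomialDensity (m : ℕ) (q : ℝ) : ℝ :=
  Real.exp (-((m : ℝ) - 1) / 2 * Real.log (2 * Real.pi) + (1 - m / 2) * Real.log m - q / (2 * m))

/-- Limiting multivariate hypergeometric density, as a function of the squared norm `q`. -/
noncomputable def hypergeometricDensity (m : ℕ) (c q : ℝ) : ℝ :=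
  Real.exp (((m : ℝ) - 1) / 2 * (Real.log c - Real.log (c - 1)) +
    (-((m : ℝ) - 1) / 2 * Real.log (2 * Real.pi) + (1 - m / 2) * Real.log m) -
      c / (c - 1) * (q / (2 * m)))

lemma abs_sub_exp_le {x t δ M : ℝ} (hx : 0 < x) (h : |Real.log x - t| ≤ δ) (hδ : δ ≤ 1)
    (ht : t ≤ M) : |x - Real.exp t| ≤ Real.exp M * (2 * δ) := by
  have h1 : x - Real.exp t = Real.exp t * (Real.exp (Real.log x - t) - 1) := by
    rw [mul_sub, ← Real.exp_add, add_sub_cancel, Real.exp_log hx, mul_one]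
  rw [h1, abs_mul, Real.abs_exp]
  have h2 := Real.abs_exp_sub_one_le (h.trans hδ)
  have h3 : Real.exp t ≤ Real.exp M := Real.exp_le_exp.2 ht
  have : 0 ≤ |Real.log x - t| := abs_nonneg _
  gcongr
  linarith

lemma abs_exp_sub_exp_le {s t M : ℝ} (hs : s ≤ M) (ht : t ≤ M) :
    |Real.exp s - Real.exp t| ≤ Real.exp M * |s - t| := by
  wlog h : t ≤ s generalizing s t
  · rw [abs_sub_comm, abs_sub_comm s]
    exact this ht hs (not_le.1 h).le
  rw [abs_of_nonneg (sub_nonneg.2 (Real.exp_le_exp.2 h)), abs_of_nonneg (sub_nonneg.2 h)]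
  have h1 : Real.exp s - Real.exp t = Real.exp s * (1 - Real.exp (t - s)) := by
    rw [mul_sub, ← Real.exp_add]; simp
  rw [h1]
  have h2 := Real.add_one_le_exp (t - s)
  have h3 : Real.exp s ≤ Real.exp M := Real.exp_le_exp.2 hs
  have h4 : 0 ≤ 1 - Real.exp (t - s) := by
    have := Real.exp_le_one_iff.2 (sub_nonpos.2 h); linarith
  calc Real.exp s * (1 - Real.exp (t - s)) ≤ Real.exp M * (1 - Real.exp (t - s)) := by gcongr
    _ ≤ Real.exp M * (s - t) := mul_le_mul_of_nonneg_left (by linarith) (Real.exp_pos M).le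

/-- The coordinates `(l i - n / m) m / √n` of a composition `l` of `n` in the central limit
scaling. -/
noncomputable def scaledCoord {m : ℕ} (n : ℕ) (l : Fin m → ℕ) (i : Fin m) : ℝ :=
  ((l i : ℝ) - n / m) * (m / Real.sqrt n)

lemma sum_sq_div_eq {m n : ℕ} (hm : 0 < m) (hn : 0 < n) (l : Fin m → ℕ) :
    (∑ i, ((l i : ℝ) - n / m) ^ 2) / (2 * (n / m)) = (∑ i, scaledCoord n l i ^ 2) / (2 * m) := by
  have hm' : (0 : ℝ) < m := by exact_mod_cast hm
  have hn' : (0 : ℝ) < n := by exact_mod_cast hn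
  simp only [scaledCoord, mul_pow, div_pow, Real.sq_sqrt hn'.le]
  rw [← Finset.sum_mul]
  generalize ∑ i, ((l i : ℝ) - n / m) ^ 2 = S
  field_simp

/-- Local limit theorems for the rescaled masses, with error `O(1/√n)`, uniformly in the central
region. -/
lemma exists_local_limit (m : ℕ) (hm : 0 < m) {c R : ℝ} (hc : 2 ≤ c) (hcm : (m : ℝ) ≤ c)
    (hR : 0 ≤ R) :
    ∃ C W : ℝ, 0 ≤ C ∧ ∀ n K : ℕ, W ≤ Real.sqrt n → ((m * K : ℕ) : ℝ) = c * n →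
      ∀ l : Fin m → ℕ, ∑ i, l i = n → (∀ i, |(l i : ℝ) - n / m| ≤ R * Real.sqrt n) →
        |(Real.sqrt n / m) ^ (m - 1) * multinomialMass (fun _ : Fin m => 1 / (m : ℝ)) n l -
          multinomialDensity m (∑ i, scaledCoord n l i ^ 2)| ≤ C / Real.sqrt n ∧
        |(Real.sqrt n / m) ^ (m - 1) * hypergeometricMass (fun _ : Fin m => K) n l -
          hypergeometricDensity m c (∑ i, scaledCoord n l i ^ 2)| ≤ C / Real.sqrt n := by
  have hm' : (0 : ℝ) < m := by exact_mod_cast hm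
  have hm1 : (1 : ℝ) ≤ m := by exact_mod_cast hm
  -- Converts deviations measured in √n to the scale √(n/m) of the expansions.
  set R' := R * Real.sqrt m with hR'
  have hR'0 : 0 ≤ R' := by positivity
  set E := (3 * m + 3) * (2 + R' + 4 * R' ^ 3) * Real.sqrt m with hE
  have hE0 : 0 ≤ E := by positivity
  set M₀ := -((m : ℝ) - 1) / 2 * Real.log (2 * Real.pi) + (1 - m / 2) * Real.log m with hM0
  set M₁ := ((m : ℝ) - 1) / 2 * (Real.log c - Real.log (c - 1)) with hM1
  -- The threshold secures both n/m ≥ 1 + 4R'² and E/√n ≤ 1; the latter allows the logarithmic error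
  -- to be exponentiated linearly.
  refine ⟨(Real.exp M₀ + Real.exp (M₁ + M₀)) * (2 * E), 1 + m * (1 + 4 * R' ^ 2) + E,
    by positivity, ?_⟩
  intro n K hW hK l hl hb
  set s := Real.sqrt n with hs
  have hs1 : 1 ≤ s := by
    have : 0 ≤ m * (1 + 4 * R' ^ 2) := by positivity
    linarith
  have hs2 : s ^ 2 = n := Real.sq_sqrt (Nat.cast_nonneg n)
  have hn' : (0 : ℝ) < n := by rw [← hs2]; positivity
  have hn : 0 < n := by exact_mod_cast hn'
  have hnm : 1 + 4 * R' ^ 2 ≤ (n / m : ℝ) := by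
    rw [le_div_iff₀ hm', ← hs2]
    have : (1 + 4 * R' ^ 2) * m ≤ s := by linarith
    nlinarith
  -- Here m ≤ c enters: no suit can run out, so every l i is at most K and the hypergeometric mass
  -- is positive.
  have hnK : n ≤ K := by
    have h1 : (m : ℝ) * n ≤ m * K := by
      push_cast at hK; rw [hK]; gcongr
    exact_mod_cast le_of_mul_le_mul_left h1 hm'
  have hsm : Real.sqrt (n / m) = s / Real.sqrt m := Real.sqrt_div (Nat.cast_nonneg n) _
  have hsqm : 0 < Real.sqrt m := Real.sqrt_pos.2 hm'
  have hb' : ∀ i, |(l i : ℝ) - n / m| ≤ R' * Real.sqrt (n / m) := fun i => by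
    rw [hsm, hR']
    refine (hb i).trans (le_of_eq ?_)
    field_simp
  have hEs : E / s ≤ 1 := by
    rw [div_le_one (by linarith)]
    have : 0 ≤ m * (1 + 4 * R' ^ 2) := by positivity
    linarith
  have herr : (3 * m + 3) * ((2 + R' + 4 * R' ^ 3) / Real.sqrt (n / m)) = E / s := by
    rw [hsm, hE]; field_simp
  have hone : 1 ≤ (n / m : ℝ) := by nlinarith [sq_nonneg R']
  have hq : 0 ≤ (∑ i, scaledCoord n l i ^ 2) / (2 * (m : ℝ)) :=
    div_nonneg (Finset.sum_nonneg fun i _ => sq_nonneg _) (by positivity)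
  have hfac : 0 < (s / m) ^ (m - 1) := by positivity
  have hlogfac : Real.log ((s / m) ^ (m - 1)) = ((m : ℝ) - 1) * (Real.log n / 2 - Real.log m) := by
    rw [Real.log_pow, Real.log_div (by linarith) hm'.ne', hs, Real.log_sqrt (Nat.cast_nonneg n),
      Nat.cast_sub hm, Nat.cast_one]
  have h1 := abs_log_multinomialMass_sub_le hm hR'0 hone (by linarith) l hl hb'
  have h2 := abs_log_hypergeometricMass_sub_le hm hR'0 hc hK hnK hone (by linarith) l hl hb'
  rw [sum_sq_div_eq hm hn] at h1 h2
  rw [herr] at h2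
  have h1' := h1.trans (show _ ≤ E / s by
    rw [← herr]; gcongr <;> linarith)
  have hmpos : 0 < multinomialMass (fun _ : Fin m => 1 / (m : ℝ)) n l := by
    rw [multinomialMass_eq n l _ hl]
    have : (0 : ℝ) < Nat.multinomial Finset.univ l := by exact_mod_cast Nat.multinomial_pos _ _
    positivity
  have hhpos : 0 < hypergeometricMass (fun _ : Fin m => K) n l := by
    rw [hypergeometricMass_eq n K l hl]
    have h3 : (0 : ℝ) < Nat.multinomial Finset.univ l := by exact_mod_cast Nat.multinomial_pos _ _
    have h4 : (0 : ℝ) < (m * K).descFactorial n := by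
      exact_mod_cast Nat.descFactorial_pos.2 (hnK.trans (Nat.le_mul_of_pos_left K hm))
    have h5 : (0 : ℝ) < ∏ i, (K.descFactorial (l i) : ℝ) := Finset.prod_pos fun i _ => by
      have : l i ≤ K := ((Finset.single_le_sum (fun j _ => Nat.zero_le (l j))
        (Finset.mem_univ i)).trans hl.le).trans hnK
      exact_mod_cast Nat.descFactorial_pos.2 this
    positivity
  have hc1 : 0 < c - 1 := by linarith
  constructor
  · have h := abs_sub_exp_le (x := (s / m) ^ (m - 1) *
      multinomialMass (fun _ : Fin m => 1 / (m : ℝ)) n l)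
      (t := M₀ - (∑ i, scaledCoord n l i ^ 2) / (2 * m)) (δ := E / s) (M := M₀)
      (by positivity) (by
        rw [Real.log_mul hfac.ne' hmpos.ne', hlogfac]
        refine le_of_eq_of_le ?_ h1'
        congr 1
        rw [hM0]; ring) hEs (by linarith)
    refine h.trans (le_of_le_of_eq (b := (Real.exp M₀ + Real.exp (M₁ + M₀)) * (2 * (E / s))) ?_
      (by ring))
    gcongr
    linarith [Real.exp_pos (M₁ + M₀)]
  · have h := abs_sub_exp_le (x := (s / m) ^ (m - 1) *
      hypergeometricMass (fun _ : Fin m => K) n l)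
      (t := M₁ + M₀ - c / (c - 1) * ((∑ i, scaledCoord n l i ^ 2) / (2 * m))) (δ := E / s)
      (M := M₁ + M₀)
      (by positivity) (by
        rw [Real.log_mul hfac.ne' hhpos.ne', hlogfac]
        refine le_of_eq_of_le ?_ h2
        congr 1
        rw [hM0]; ring) hEs (by
        have : 0 ≤ c / (c - 1) * ((∑ i, scaledCoord n l i ^ 2) / (2 * m)) := by positivity
        linarith)
    refine h.trans (le_of_le_of_eq (b := (Real.exp M₀ + Real.exp (M₁ + M₀)) * (2 * (E / s))) ?_
      (by ring))
    gcongr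
    linarith [Real.exp_pos M₀]

/-- On q ≥ 0 both exponents are affine and bounded above, so the exponentials are Lipschitz. This
pays for moving from a lattice point to an arbitrary point of its cell. -/
lemma exists_densities_lipschitz (m : ℕ) (hm : 0 < m) {c : ℝ} (hc : 2 ≤ c) :
    ∃ L : ℝ, 0 ≤ L ∧ ∀ q q' : ℝ, 0 ≤ q → 0 ≤ q' →
      |multinomialDensity m q - multinomialDensity m q'| ≤ L * |q - q'| ∧
      |hypergeometricDensity m c q - hypergeometricDensity m c q'| ≤ L * |q - q'| := by
  have hm' : (0 : ℝ) < m := by exact_mod_cast hm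
  have hc1 : 0 < c - 1 := by linarith
  set M₀ := -((m : ℝ) - 1) / 2 * Real.log (2 * Real.pi) + (1 - m / 2) * Real.log m with hM0
  set M₁ := ((m : ℝ) - 1) / 2 * (Real.log c - Real.log (c - 1)) with hM1
  refine ⟨Real.exp M₀ * (1 / (2 * m)) + Real.exp (M₁ + M₀) * (c / (c - 1) * (1 / (2 * m))),
    by positivity, fun q q' hq hq' => ?_⟩
  have e0 : 0 ≤ Real.exp M₀ * (1 / (2 * m)) := by positivity
  have e1 : 0 ≤ Real.exp (M₁ + M₀) * (c / (c - 1) * (1 / (2 * m))) := by positivity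
  constructor
  · refine (abs_exp_sub_exp_le (M := M₀) (sub_le_self _ (by positivity))
      (sub_le_self _ (by positivity))).trans ?_
    have : M₀ - q / (2 * m) - (M₀ - q' / (2 * m)) = -(1 / (2 * m)) * (q - q') := by ring
    rw [this, abs_mul, abs_neg, abs_of_nonneg (by positivity : (0 : ℝ) ≤ 1 / (2 * m)), ← mul_assoc]
    gcongr
    linarith
  · refine (abs_exp_sub_exp_le (M := M₁ + M₀) (sub_le_self _ (by positivity))
      (sub_le_self _ (by positivity))).trans ?_
    have : M₁ + M₀ - c / (c - 1) * (q / (2 * m)) - (M₁ + M₀ - c / (c - 1) * (q' / (2 * m))) =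
        -(c / (c - 1) * (1 / (2 * m))) * (q - q') := by ring
    rw [this, abs_mul, abs_neg,
      abs_of_nonneg (by positivity : (0 : ℝ) ≤ c / (c - 1) * (1 / (2 * m))), ← mul_assoc]
    gcongr
    linarith

/-- The hypergeometric density exceeds the multinomial one exactly in a ball. -/
lemma hypergeometricDensity_le_iff {m : ℕ} (hm : 0 < m) {c q : ℝ} (hc : 2 ≤ c) :
    hypergeometricDensity m c q ≤ multinomialDensity m q ↔
      (m : ℝ) * (m - 1) * (c - 1) * Real.log (c / (c - 1)) ≤ q := by
  have hm' : (0 : ℝ) < m := by exact_mod_cast hm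
  have hc1 : 0 < c - 1 := by linarith
  rw [hypergeometricDensity, multinomialDensity, Real.exp_le_exp,
    Real.log_div (by linarith) hc1.ne']
  have h1 : c / (c - 1) * (q / (2 * m)) - q / (2 * m) = q / (2 * m * (c - 1)) := by
    field_simp; ring
  have h2 : ((m : ℝ) - 1) / 2 * (Real.log c - Real.log (c - 1)) ≤ q / (2 * m * (c - 1)) ↔
      (m : ℝ) * (m - 1) * (c - 1) * (Real.log c - Real.log (c - 1)) ≤ q := by
    rw [le_div_iff₀ (by positivity)]
    constructor <;> intro h <;> linarith
  rw [← h2]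
  constructor <;> intro h <;> linarith

/-! ### Lattice cells and step functions on the hyperplane. -/

lemma hyperplanePoint_castSucc {p : ℕ} (y : Fin p → ℝ) (i : Fin p) :
    hyperplanePoint (p + 1) y i.castSucc = y i := by
  simp [hyperplanePoint]

lemma hyperplanePoint_last {p : ℕ} (y : Fin p → ℝ) :
    hyperplanePoint (p + 1) y (Fin.last p) = -∑ j, y j := by
  simp [hyperplanePoint]

/-- The positive part of the difference of the limiting densities, in the coordinates of the
hyperplane. -/
noncomputable def limitProfile (m : ℕ) (c : ℝ) (y : Fin (m - 1) → ℝ) : ℝ :=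
  max (hypergeometricDensity m c (∑ i, hyperplanePoint m y i ^ 2) -
    multinomialDensity m (∑ i, hyperplanePoint m y i ^ 2)) 0

/-- The cube of points whose rescaled first coordinates round down to the composition `l`. -/
def cell {p : ℕ} (n : ℕ) (l : Fin (p + 1) → ℕ) : Set (Fin p → ℝ) :=
  Set.univ.pi fun i => Set.Ico (scaledCoord n l i.castSucc)
    (scaledCoord n l i.castSucc + ((p + 1 : ℕ) : ℝ) / Real.sqrt n)

lemma measurableSet_cell {p : ℕ} (n : ℕ) (l : Fin (p + 1) → ℕ) : MeasurableSet (cell n l) :=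
  MeasurableSet.univ_pi fun _ => measurableSet_Ico

lemma volume_cell {p : ℕ} (n : ℕ) (l : Fin (p + 1) → ℕ) :
    volume (cell n l) = ENNReal.ofReal (((p + 1 : ℕ) : ℝ) / Real.sqrt n) ^ p := by
  rw [cell, Real.volume_pi_Ico]
  simp

lemma mem_cell_iff {p n : ℕ} (hn : 0 < n) (l : Fin (p + 1) → ℕ) (y : Fin p → ℝ) :
    y ∈ cell n l ↔ ∀ i, (l i.castSucc : ℝ) ≤ n / (p + 1 : ℕ) + y i * (Real.sqrt n / (p + 1 : ℕ)) ∧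
      n / (p + 1 : ℕ) + y i * (Real.sqrt n / (p + 1 : ℕ)) < l i.castSucc + 1 := by
  have hm : (0 : ℝ) < (p + 1 : ℕ) := by positivity
  have hs : 0 < Real.sqrt n := Real.sqrt_pos.2 (by exact_mod_cast hn)
  simp only [cell, Set.mem_univ_pi, Set.mem_Ico, scaledCoord]
  refine forall_congr' fun i => and_congr ?_ ?_
  · rw [← sub_le_iff_le_add', ← mul_div_assoc, ← mul_div_assoc, div_le_iff₀ hs, le_div_iff₀ hm]
  · rw [← lt_sub_iff_add_lt', ← mul_div_assoc, ← mul_div_assoc, ← add_div, lt_div_iff₀ hs,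
      div_lt_iff₀ hm]
    constructor <;> intro h <;> linarith

/-- The step function with value `(√n / m) ^ p * g l` on the cell of `l`. -/
noncomputable def stepFunction {p : ℕ} (n : ℕ) (g : (Fin (p + 1) → ℕ) → ℝ) (y : Fin p → ℝ) : ℝ :=
  ∑ l ∈ Finset.piAntidiag (Finset.univ : Finset (Fin (p + 1))) n,
    (cell n l).indicator (fun _ => (Real.sqrt n / (p + 1 : ℕ)) ^ p * g l) y

lemma integrable_indicator_cell {p : ℕ} (n : ℕ) (l : Fin (p + 1) → ℕ) (a : ℝ) :
    Integrable ((cell n l).indicator fun _ => a) := by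
  rw [integrable_indicator_iff (measurableSet_cell n l), integrableOn_const_iff (by simp)]
  right
  rw [volume_cell]
  exact ENNReal.pow_lt_top ENNReal.ofReal_lt_top

lemma integrable_stepFunction {p : ℕ} (n : ℕ) (g : (Fin (p + 1) → ℕ) → ℝ) :
    Integrable (stepFunction n g) :=
  integrable_finsetSum _ fun l _ => integrable_indicator_cell n l _

/-- The scaling factor is the reciprocal of the cell volume, so sums over compositions become
integrals exactly. -/
lemma integral_stepFunction {p n : ℕ} (hn : 0 < n) (g : (Fin (p + 1) → ℕ) → ℝ) :
    ∫ y, stepFunction n g y = ∑ l ∈ Finset.piAntidiag Finset.univ n, g l := by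
  have hs : 0 < Real.sqrt n := Real.sqrt_pos.2 (by exact_mod_cast hn)
  simp only [stepFunction]
  rw [integral_finsetSum _ fun l _ => integrable_indicator_cell n l _]
  refine Finset.sum_congr rfl fun l _ => ?_
  rw [integral_indicator (measurableSet_cell n l), setIntegral_const, measureReal_def, volume_cell,
    ENNReal.toReal_pow, ENNReal.toReal_ofReal (by positivity), smul_eq_mul, ← mul_assoc, ← mul_pow]
  have : ((p + 1 : ℕ) : ℝ) / Real.sqrt n * (Real.sqrt n / (p + 1 : ℕ)) = 1 := by
    field_simp
  rw [this, one_pow, one_mul]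

/-- A point determines the first p entries as floors, and the total n determines the last. -/
lemma eq_of_mem_cell {p n : ℕ} (hn : 0 < n) {l l' : Fin (p + 1) → ℕ} (hl : ∑ i, l i = n)
    (hl' : ∑ i, l' i = n) {y : Fin p → ℝ} (h : y ∈ cell n l) (h' : y ∈ cell n l') : l = l' := by
  rw [mem_cell_iff hn] at h h'
  have h1 : ∀ i : Fin p, l i.castSucc = l' i.castSucc := fun i => by
    have a1 : (l i.castSucc : ℝ) < l' i.castSucc + 1 := (h i).1.trans_lt (h' i).2
    have a2 : (l' i.castSucc : ℝ) < l i.castSucc + 1 := (h' i).1.trans_lt (h i).2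
    have a3 : l i.castSucc < l' i.castSucc + 1 := by exact_mod_cast a1
    have a4 : l' i.castSucc < l i.castSucc + 1 := by exact_mod_cast a2
    omega
  rw [Fin.sum_univ_castSucc] at hl hl'
  simp only [h1] at hl
  funext i
  refine Fin.lastCases ?_ h1 i
  omega

lemma stepFunction_eq_of_mem_cell {p n : ℕ} (hn : 0 < n) (g : (Fin (p + 1) → ℕ) → ℝ)
    {l : Fin (p + 1) → ℕ} (hl : ∑ i, l i = n) {y : Fin p → ℝ} (h : y ∈ cell n l) :
    stepFunction n g y = (Real.sqrt n / (p + 1 : ℕ)) ^ p * g l := by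
  rw [stepFunction, Finset.sum_eq_single_of_mem l (by simpa using hl), Set.indicator_of_mem h]
  intro l' hl' hne
  refine Set.indicator_of_notMem (fun h' => hne ?_) _
  exact eq_of_mem_cell hn (by simpa using hl') hl h' h

lemma exists_mem_cell {p n : ℕ} (hn : 0 < n) {R : ℝ} (hR : 0 ≤ R)
    (hRn : (p + 1 : ℕ) * R ≤ Real.sqrt n) {y : Fin p → ℝ} (hy : ∀ i, |y i| ≤ R) :
    ∃ l : Fin (p + 1) → ℕ, ∑ i, l i = n ∧ y ∈ cell n l := by
  have hm : (0 : ℝ) < (p + 1 : ℕ) := by positivity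
  have hpm : (p : ℝ) + 1 = (p + 1 : ℕ) := by push_cast; rfl
  have hs : 0 < Real.sqrt n := Real.sqrt_pos.2 (by exact_mod_cast hn)
  have hs2 : Real.sqrt n ^ 2 = n := Real.sq_sqrt (Nat.cast_nonneg n)
  set t : Fin p → ℝ := fun i => n / (p + 1 : ℕ) + y i * (Real.sqrt n / (p + 1 : ℕ)) with ht
  have hmR : R ≤ (p + 1 : ℕ) * R := by
    rw [← hpm]; nlinarith [(Nat.cast_nonneg p : (0 : ℝ) ≤ p)]
  have ht0 : ∀ i, 0 ≤ t i := fun i => by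
    have h1 : t i = (Real.sqrt n / (p + 1 : ℕ)) * (Real.sqrt n + y i) := by
      simp only [ht]; nth_rewrite 1 [← hs2]; ring
    rw [h1]
    have := (abs_le.1 (hy i)).1
    have : 0 ≤ Real.sqrt n + y i := by linarith
    positivity
  have hsum : ∑ i, ⌊t i⌋₊ ≤ n := by
    have h1 : ((∑ i, ⌊t i⌋₊ : ℕ) : ℝ) ≤ ∑ i : Fin p, (n / (p + 1 : ℕ) + R * (Real.sqrt n / (p + 1 : ℕ))) := by
      push_cast
      refine Finset.sum_le_sum fun i _ => (Nat.floor_le (ht0 i)).trans ?_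
      have := (abs_le.1 (hy i)).2
      simp only [ht]
      push_cast
      gcongr
    simp only [Finset.sum_const, Finset.card_univ, Fintype.card_fin, nsmul_eq_mul] at h1
    have h2 : (p : ℝ) * (n / (p + 1 : ℕ) + R * (Real.sqrt n / (p + 1 : ℕ))) ≤ n := by
      have h3 : (p : ℝ) * (n / (p + 1 : ℕ) + R * (Real.sqrt n / (p + 1 : ℕ))) =
          (p * n + p * R * Real.sqrt n) / (p + 1 : ℕ) := by ring
      rw [h3, div_le_iff₀ hm, ← hpm]
      have h4 : (p : ℝ) * R ≤ Real.sqrt n := by rw [← hpm] at hRn; linarith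
      nlinarith
    exact_mod_cast h1.trans h2
  -- By `hsum` the natural subtraction does not truncate.
  refine ⟨Fin.snoc (α := fun _ => ℕ) (fun i => ⌊t i⌋₊) (n - ∑ i, ⌊t i⌋₊), ?_, ?_⟩
  · rw [Fin.sum_univ_castSucc]
    simp only [Fin.snoc_castSucc, Fin.snoc_last]
    omega
  · rw [mem_cell_iff hn]
    intro i
    simp only [Fin.snoc_castSucc]
    exact ⟨Nat.floor_le (ht0 i), Nat.lt_floor_add_one _⟩

/-- Each of the first p coordinates is off by at most the cell side; the last, minus their sum,
accumulates p such errors. -/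
lemma abs_scaledCoord_sub_le {p n : ℕ} {l : Fin (p + 1) → ℕ} (hl : ∑ i, l i = n)
    {y : Fin p → ℝ} (h : y ∈ cell n l) (i : Fin (p + 1)) :
    |scaledCoord n l i - hyperplanePoint (p + 1) y i| ≤
      ((p + 1 : ℕ) : ℝ) ^ 2 / Real.sqrt n := by
  set δ : ℝ := ((p + 1 : ℕ) : ℝ) / Real.sqrt n with hδ
  have hδ0 : 0 ≤ δ := by positivity
  have hpm : (p : ℝ) + 1 = (p + 1 : ℕ) := by push_cast; rfl
  have hp0 : (0 : ℝ) ≤ p := Nat.cast_nonneg p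
  have h1 : ∀ j : Fin p, |scaledCoord n l j.castSucc - y j| ≤ δ := fun j => by
    have := (Set.mem_univ_pi.1 h) j
    rw [abs_le]
    constructor <;> linarith [this.1, this.2]
  have h2 : ((p + 1 : ℕ) : ℝ) ^ 2 / Real.sqrt n = (p + 1) * δ := by rw [hδ, hpm]; ring
  rw [h2]
  refine Fin.lastCases ?_ (fun j => ?_) i
  · have h3 : ∑ i, scaledCoord n l i = 0 := by
      simp only [scaledCoord]
      rw [← Finset.sum_mul, sum_sub_div_eq_zero (Nat.succ_pos p) l hl, zero_mul]
    rw [Fin.sum_univ_castSucc] at h3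
    rw [hyperplanePoint_last]
    have h4 : scaledCoord n l (Fin.last p) - -∑ j, y j =
        -∑ j : Fin p, (scaledCoord n l j.castSucc - y j) := by
      rw [Finset.sum_sub_distrib]; linarith
    rw [h4, abs_neg]
    refine (Finset.abs_sum_le_sum_abs _ _).trans ((Finset.sum_le_sum fun j _ => h1 j).trans ?_)
    simp only [Finset.sum_const, Finset.card_univ, Fintype.card_fin, nsmul_eq_mul]
    nlinarith
  · rw [hyperplanePoint_castSucc]
    refine (h1 j).trans ?_
    nlinarith

lemma abs_hyperplanePoint_le {p : ℕ} {R : ℝ} (hR : 0 ≤ R) {y : Fin p → ℝ} (hy : ∀ i, |y i| ≤ R)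
    (i : Fin (p + 1)) : |hyperplanePoint (p + 1) y i| ≤ ((p + 1 : ℕ) : ℝ) * R := by
  have hpm : (p : ℝ) + 1 = (p + 1 : ℕ) := by push_cast; rfl
  have hp0 : (0 : ℝ) ≤ p := Nat.cast_nonneg p
  rw [← hpm]
  refine Fin.lastCases ?_ (fun j => ?_) i
  · rw [hyperplanePoint_last, abs_neg]
    refine (Finset.abs_sum_le_sum_abs _ _).trans ((Finset.sum_le_sum fun j _ => hy j).trans ?_)
    simp only [Finset.sum_const, Finset.card_univ, Fintype.card_fin, nsmul_eq_mul]
    nlinarith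
  · rw [hyperplanePoint_castSucc]
    refine (hy j).trans ?_
    nlinarith

lemma abs_sum_sq_sub_sum_sq_le {ι : Type*} [Fintype ι] {x y : ι → ℝ} {δ B : ℝ}
    (h : ∀ i, |x i - y i| ≤ δ) (hy : ∀ i, |y i| ≤ B) :
    |∑ i, x i ^ 2 - ∑ i, y i ^ 2| ≤ Fintype.card ι * (δ * (2 * B + δ)) := by
  rw [← Finset.sum_sub_distrib]
  refine (Finset.abs_sum_le_sum_abs _ _).trans ?_
  rw [← nsmul_eq_mul, ← Finset.card_univ, ← Finset.sum_const]
  refine Finset.sum_le_sum fun i _ => ?_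
  have h1 : x i ^ 2 - y i ^ 2 = (x i - y i) * (2 * y i + (x i - y i)) := by ring
  rw [h1, abs_mul]
  have h2 : |2 * y i + (x i - y i)| ≤ 2 * B + δ := by
    refine (abs_add_le _ _).trans ?_
    rw [abs_mul, abs_two]
    linarith [h i, hy i]
  exact mul_le_mul (h i) h2 (abs_nonneg _) ((abs_nonneg _).trans (h i))

lemma sq_le_sum_sq_hyperplanePoint {p : ℕ} (y : Fin p → ℝ) (j : Fin p) :
    y j ^ 2 ≤ ∑ i, hyperplanePoint (p + 1) y i ^ 2 := by
  rw [← hyperplanePoint_castSucc y j]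
  exact Finset.single_le_sum (f := fun i => hyperplanePoint (p + 1) y i ^ 2)
    (fun i _ => sq_nonneg _) (Finset.mem_univ _)

/-! ### From the sum over compositions to the integral. -/

/-- The positive part of the difference of the two masses at `l`. -/
noncomputable def massExcess (m n K : ℕ) (l : Fin m → ℕ) : ℝ :=
  max (hypergeometricMass (fun _ : Fin m => K) n l -
    multinomialMass (fun _ : Fin m => 1 / (m : ℝ)) n l) 0

/-- The rescaled step function of the mass excess is within `O(1/√n)` of the limiting profile, with
both vanishing outside a fixed cube. -/
lemma exists_abs_stepFunction_sub_le (p : ℕ) {c : ℝ} (hc : 2 ≤ c) (hcm : ((p + 1 : ℕ) : ℝ) ≤ c) :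
    ∃ C W R : ℝ, 0 ≤ C ∧ (∀ y : Fin p → ℝ, (¬ ∀ i, |y i| ≤ R) → limitProfile (p + 1) c y = 0) ∧
      ∀ n K : ℕ, W ≤ Real.sqrt n → (((p + 1) * K : ℕ) : ℝ) = c * n →
      ∀ y : Fin p → ℝ,
        ((∀ i, |y i| ≤ R) →
          |stepFunction n (massExcess (p + 1) n K) y - limitProfile (p + 1) c y| ≤
            C / Real.sqrt n) ∧
        ((¬ ∀ i, |y i| ≤ R) → stepFunction n (massExcess (p + 1) n K) y = 0) := by
  have hmpos : 0 < p + 1 := Nat.succ_pos p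
  have hm1 : (1 : ℝ) ≤ (p + 1 : ℕ) := by exact_mod_cast hmpos
  obtain ⟨m, hmdef⟩ : ∃ m : ℝ, m = (p + 1 : ℕ) := ⟨_, rfl⟩
  rw [← hmdef] at hm1 hcm
  have hm0 : 0 < m := by linarith
  set r := Real.sqrt (m * (m - 1) * (c - 1) * Real.log (c / (c - 1))) with hr
  have hr0 : 0 ≤ r := Real.sqrt_nonneg _
  have hsc := Real.sqrt_nonneg (24 * c)
  -- Beyond r the limit profile vanishes. Beyond m(√(24c) + 2) a coordinate of y means a deviation
  -- of at least (√(24c) + 2)√n before rounding; rounding costs 1, leaving √(24cn) + 1 as the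
  -- domination lemma requires.
  set R := r + m * (Real.sqrt (24 * c) + 2) with hR
  have hR0 : 0 ≤ R := by positivity
  obtain ⟨C₁, W₁, hC1, hloc⟩ := exists_local_limit (p + 1) hmpos hc (hmdef ▸ hcm)
    (R := R + m) (by positivity)
  obtain ⟨L, hL0, hLip⟩ := exists_densities_lipschitz (p + 1) hmpos hc
  have hvanish : ∀ y : Fin p → ℝ, (¬ ∀ i, |y i| ≤ R) → limitProfile (p + 1) c y = 0 := by
    intro y hy
    push Not at hy
    obtain ⟨i, hi⟩ := hy
    rw [limitProfile, max_eq_right]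
    rw [sub_nonpos, hypergeometricDensity_le_iff hmpos hc, ← hmdef]
    refine le_trans ?_ (sq_le_sum_sq_hyperplanePoint y i)
    rw [← sq_abs]
    have h1 : r ≤ |y i| := by
      have : 0 ≤ m * (Real.sqrt (24 * c) + 2) := by positivity
      linarith
    exact (Real.sqrt_le_left (abs_nonneg _)).1 h1
  refine ⟨2 * (C₁ + L * (m * (m ^ 2 * (2 * (m * R) + m ^ 2)))), 1 + |W₁| + m * R + 4 * m, R,
    by positivity, hvanish, ?_⟩
  intro n K hW hK y
  set s := Real.sqrt n with hs
  have hmR : 0 ≤ m * R := by positivity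
  have hs1 : 1 ≤ s := by linarith [abs_nonneg W₁]
  have hs2 : s ^ 2 = n := Real.sq_sqrt (Nat.cast_nonneg n)
  have hn' : (0 : ℝ) < n := by rw [← hs2]; positivity
  have hn : 0 < n := by exact_mod_cast hn'
  constructor
  · intro hy
    obtain ⟨l, hl, hyl⟩ := exists_mem_cell hn hR0
      (by rw [← hmdef]; linarith [abs_nonneg W₁]) hy
    rw [stepFunction_eq_of_mem_cell hn _ hl hyl]
    have hX := abs_scaledCoord_sub_le hl hyl
    have hH := abs_hyperplanePoint_le hR0 hy
    have hQ := abs_sum_sq_sub_sum_sq_le hX hH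
    simp only [Fintype.card_fin] at hQ
    rw [← hmdef, ← hs] at hQ
    have hQ' : |∑ i, scaledCoord n l i ^ 2 - ∑ i, hyperplanePoint (p + 1) y i ^ 2| ≤
        m * (m ^ 2 * (2 * (m * R) + m ^ 2)) / s := by
      refine hQ.trans ?_
      have h1 : m ^ 2 / s ≤ m ^ 2 := div_le_self (by positivity) hs1
      calc m * (m ^ 2 / s * (2 * (m * R) + m ^ 2 / s))
          ≤ m * (m ^ 2 / s * (2 * (m * R) + m ^ 2)) := by gcongr
        _ = _ := by ring
    -- Unscaling |scaledCoord| ≤ m²/s + mR by s/m gives m + Rs, hence the radius R + m passed to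
    -- `exists_local_limit`.
    have hbulk : ∀ i, |(l i : ℝ) - n / (p + 1 : ℕ)| ≤ (R + m) * s := fun i => by
      have h1 : |scaledCoord n l i| ≤ m ^ 2 / s + m * R := by
        have h2 : scaledCoord n l i = (scaledCoord n l i - hyperplanePoint (p + 1) y i) +
          hyperplanePoint (p + 1) y i := by ring
        rw [h2]
        refine (abs_add_le _ _).trans (add_le_add ?_ ?_)
        · simpa only [← hmdef] using hX i
        · simpa only [← hmdef] using hH i
      rw [scaledCoord, abs_mul, ← hmdef, ← hs, abs_of_pos (by positivity : 0 < m / s),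
        ← mul_div_assoc, div_le_iff₀ (by positivity), add_mul, div_mul_cancel₀ _ (by positivity)]
        at h1
      rw [← hmdef]
      have h3 : |(l i : ℝ) - n / m| * m ≤ ((R + m) * s) * m := by nlinarith
      exact le_of_mul_le_mul_right h3 hm0
    have hW1 : W₁ ≤ s := by linarith [le_abs_self W₁]
    obtain ⟨h1, h2⟩ := hloc n K hW1 hK l hl hbulk
    rw [Nat.add_sub_cancel, ← hs, ← hmdef] at h1 h2
    obtain ⟨h3, h4⟩ := hLip (∑ i, scaledCoord n l i ^ 2) (∑ i, hyperplanePoint (p + 1) y i ^ 2)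
      (Finset.sum_nonneg fun i _ => sq_nonneg _) (Finset.sum_nonneg fun i _ => sq_nonneg _)
    have h3' := h3.trans (mul_le_mul_of_nonneg_left hQ' hL0)
    have h4' := h4.trans (mul_le_mul_of_nonneg_left hQ' hL0)
    have hpow : 0 ≤ (s / m) ^ p := by positivity
    rw [massExcess, limitProfile, ← hmdef, mul_max_of_nonneg _ _ hpow, mul_zero, mul_sub]
    -- The positive part is 1-Lipschitz, so the errors of the two densities simply add.
    refine (abs_max_sub_max_le_abs _ _ 0).trans ?_
    have hconst : 2 * (C₁ + L * (m * (m ^ 2 * (2 * (m * R) + m ^ 2)))) / s =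
        2 * (C₁ / s + L * (m * (m ^ 2 * (2 * (m * R) + m ^ 2)) / s)) := by ring
    rw [hconst]
    rw [abs_le] at *
    constructor <;> linarith [h1.1, h1.2, h2.1, h2.2, h3'.1, h3'.2, h4'.1, h4'.2]
  · intro hy
    push Not at hy
    obtain ⟨i, hi⟩ := hy
    refine Finset.sum_eq_zero fun l hl => ?_
    have hl' : ∑ i, l i = n := by simpa using hl
    by_cases hyl : y ∈ cell n l
    · rw [Set.indicator_of_mem hyl]
      have hnK : n ≤ K := by
        have h1 : m * n ≤ m * K := by
          push_cast at hK
          have : m * K = c * n := by rw [← hK, hmdef]; push_cast; ring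
          rw [this]; gcongr
        exact_mod_cast le_of_mul_le_mul_left h1 hm0
      have h4m : 4 ≤ (n / (p + 1 : ℕ) : ℝ) := by
        rw [← hmdef, le_div_iff₀ hm0, ← hs2]
        have : 4 * m ≤ s := by linarith [abs_nonneg W₁]
        nlinarith
      have hdev : Real.sqrt (24 * c * n) + 1 ≤ |(l i.castSucc : ℝ) - n / (p + 1 : ℕ)| := by
        rw [Real.sqrt_mul (by positivity), ← hs, ← hmdef]
        have h1 := (mem_cell_iff hn l y).1 hyl i
        rw [← hs, ← hmdef] at h1
        have h2 : |y i * (s / m)| - 1 ≤ |(l i.castSucc : ℝ) - n / m| := by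
          have h3 : |y i * (s / m)| ≤ |(l i.castSucc : ℝ) - n / m| + 1 := by
            have h4 : y i * (s / m) = ((l i.castSucc : ℝ) - n / m) +
              (n / m + y i * (s / m) - l i.castSucc) := by ring
            rw [h4]
            refine (abs_add_le _ _).trans (add_le_add_right ?_ _)
            rw [abs_le]; constructor <;> linarith [h1.1, h1.2]
          linarith
        refine le_trans ?_ h2
        rw [abs_mul, abs_of_pos (by positivity : 0 < s / m)]
        have h5 : (Real.sqrt (24 * c) + 2) * s ≤ |y i| * (s / m) := by
          rw [← mul_div_assoc, le_div_iff₀ hm0]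
          have h6 : m * (Real.sqrt (24 * c) + 2) ≤ |y i| := by linarith
          nlinarith
        linarith
      have h := hypergeometricMass_le_multinomialMass hmpos hc hK hnK h4m l hl' i.castSucc hdev
      rw [massExcess, max_eq_right (by linarith), mul_zero]
    · exact Set.indicator_of_notMem hyl _

lemma continuous_limitProfile (m : ℕ) (c : ℝ) : Continuous (limitProfile m c) := by
  have h : ∀ i, Continuous fun y : Fin (m - 1) → ℝ => hyperplanePoint m y i := by
    intro i
    simp only [hyperplanePoint]
    split_ifs <;> fun_prop
  unfold limitProfile hypergeometricDensity multinomialDensity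
  fun_prop

/-- A uniform O(1/√n) error, supported in a cube that does not depend on n, integrates to O(1/√n).
-/
lemma exists_abs_tvDist_sub_integral_le (p : ℕ) {c : ℝ} (hc : 2 ≤ c)
    (hcm : ((p + 1 : ℕ) : ℝ) ≤ c) :
    ∃ C W : ℝ, 0 ≤ C ∧ ∀ n K : ℕ, W ≤ Real.sqrt n → (((p + 1) * K : ℕ) : ℝ) = c * n →
      |tvDist (hypergeometricMass (fun _ : Fin (p + 1) => K) n)
          (multinomialMass (fun _ : Fin (p + 1) => 1 / ((p + 1 : ℕ) : ℝ)) n) -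
        ∫ y, limitProfile (p + 1) c y| ≤ C / Real.sqrt n := by
  obtain ⟨C, W, R, hC, hvan, hstep⟩ := exists_abs_stepFunction_sub_le p hc hcm
  set B : Set (Fin p → ℝ) := Set.univ.pi fun _ => Set.Icc (-R) R with hB
  have hmem : ∀ y, y ∈ B ↔ ∀ i, |y i| ≤ R := fun y => by
    simp only [hB, Set.mem_univ_pi, Set.mem_Icc, abs_le]
  have hBc : IsCompact B := isCompact_univ_pi fun _ => isCompact_Icc
  have hBm : MeasurableSet B := hBc.measurableSet
  refine ⟨C * volume.real B, max W 1, by positivity, fun n K hW hK => ?_⟩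
  have hn : 0 < n := by
    have h1 : 1 ≤ Real.sqrt n := (le_max_right _ _).trans hW
    by_contra h
    have : n = 0 := by omega
    rw [this] at h1; norm_num at h1
  have hint : Integrable (fun y : Fin p → ℝ => limitProfile (p + 1) c y) := by
    have h1 : IntegrableOn (fun y : Fin p → ℝ => limitProfile (p + 1) c y) B :=
      (continuous_limitProfile (p + 1) c).continuousOn.integrableOn_compact hBc
    rw [← integrable_indicator_iff hBm] at h1
    refine h1.congr (Filter.Eventually.of_forall fun y => ?_)
    by_cases hy : y ∈ B
    · exact Set.indicator_of_mem hy _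
    · rw [Set.indicator_of_notMem hy]
      exact (hvan y (by rwa [← hmem])).symm
  rw [tvDist_hypergeometric_multinomial_eq_sum]
  have h1 := integral_stepFunction hn (massExcess (p + 1) n K)
  simp only [massExcess] at h1
  rw [← h1]
  change |_ - ∫ y : Fin p → ℝ, limitProfile (p + 1) c y| ≤ _
  rw [← integral_sub (integrable_stepFunction n _) hint]
  have h2 : Integrable (B.indicator fun _ => C / Real.sqrt n) := by
    rw [integrable_indicator_iff hBm]
    exact integrableOn_const hBc.measure_lt_top.ne
  have h3 : ∫ y, B.indicator (fun _ => C / Real.sqrt n) y = C * volume.real B / Real.sqrt n := by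
    rw [integral_indicator hBm, setIntegral_const, smul_eq_mul]
    ring
  rw [← h3, ← Real.norm_eq_abs]
  refine norm_integral_le_of_norm_le h2 (Filter.Eventually.of_forall fun y => ?_)
  obtain ⟨ha, hb⟩ := hstep n K ((le_max_left _ _).trans hW) hK y
  by_cases hy : y ∈ B
  · rw [Set.indicator_of_mem hy]
    exact ha ((hmem y).1 hy)
  · have hy' : ¬ ∀ i, |y i| ≤ R := by rwa [← hmem]
    rw [Set.indicator_of_notMem hy, hb hy', hvan y hy']
    simp

/-! ### Identification of the limit with the integral of the profile over the region. -/

lemma multinomialDensity_le_iff {m : ℕ} (hm : 0 < m) {c q : ℝ} (hc : 2 ≤ c) :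
    multinomialDensity m q ≤ hypergeometricDensity m c q ↔
      q ≤ (m : ℝ) * (m - 1) * (c - 1) * Real.log (c / (c - 1)) := by
  have hm' : (0 : ℝ) < m := by exact_mod_cast hm
  have hc1 : 0 < c - 1 := by linarith
  rw [hypergeometricDensity, multinomialDensity, Real.exp_le_exp,
    Real.log_div (by linarith) hc1.ne']
  have h1 : c / (c - 1) * (q / (2 * m)) - q / (2 * m) = q / (2 * m * (c - 1)) := by
    field_simp; ring
  have h2 : q / (2 * m * (c - 1)) ≤ ((m : ℝ) - 1) / 2 * (Real.log c - Real.log (c - 1)) ↔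
      q ≤ (m : ℝ) * (m - 1) * (c - 1) * (Real.log c - Real.log (c - 1)) := by
    rw [div_le_iff₀ (by positivity)]
    constructor <;> intro h <;> linarith
  rw [← h2]
  constructor <;> intro h <;> linarith

/-- The normalisation is at most 1 because c/(c - 1) ≤ 2 ≤ 2π, and m^(1 - m/2) ≤ 1 for m ≥ 2. -/
lemma hypergeometricDensity_le_one {m : ℕ} (hm : 2 ≤ m) {c q : ℝ} (hc : 2 ≤ c) (hq : 0 ≤ q) :
    hypergeometricDensity m c q ≤ 1 := by
  have hm' : (2 : ℝ) ≤ m := by exact_mod_cast hm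
  have hc1 : 0 < c - 1 := by linarith
  rw [hypergeometricDensity, Real.exp_le_one_iff, ← Real.log_div (by linarith) hc1.ne']
  have h1 : Real.log (c / (c - 1)) ≤ Real.log (2 * Real.pi) := by
    refine Real.log_le_log (by positivity) ?_
    rw [div_le_iff₀ hc1]
    nlinarith [Real.pi_gt_three]
  have h2 : 0 ≤ Real.log m := Real.log_nonneg (by linarith)
  have h3 : 0 ≤ c / (c - 1) * (q / (2 * m)) := by positivity
  have h4 := mul_nonneg (sub_nonneg.2 h1) (show (0 : ℝ) ≤ (m - 1) / 2 by linarith)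
  have h5 := mul_nonneg h2 (show (0 : ℝ) ≤ m / 2 - 1 by linarith)
  linarith

/-- With m = 2d the prefactor of the profile is (2π)^(-(m-1)/2) m^(1-m/2). -/
lemma profile_eq (d : ℕ) [NeZero d] {c : ℝ} (hc : 2 ≤ c) (X : EuclideanSpace ℝ (Fin (2 * d))) :
    profile d c X = hypergeometricDensity (2 * d) c (∑ i, X i ^ 2) -
      multinomialDensity (2 * d) (∑ i, X i ^ 2) := by
  have hd : (0 : ℝ) < d := by exact_mod_cast NeZero.pos d
  have hc1 : 0 < c - 1 := by linarith
  have hcc : 0 < c / (c - 1) := by positivity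
  rw [profile, EuclideanSpace.real_norm_sq_eq, hypergeometricDensity, multinomialDensity,
    Real.rpow_def_of_pos Real.pi_pos, Real.rpow_def_of_pos two_pos, Real.rpow_def_of_pos hd,
    Real.rpow_def_of_pos hcc, mul_sub, ← Real.exp_add, ← Real.exp_add, ← Real.exp_add,
    ← Real.exp_add, ← Real.exp_add, Real.log_div (by linarith) hc1.ne']
  push_cast
  rw [Real.log_mul two_ne_zero Real.pi_pos.ne', Real.log_mul two_ne_zero hd.ne']
  congr 2
  · field_simp
    ring
  · field_simp
    ring

lemma radius_sq_eq (d : ℕ) [NeZero d] {c : ℝ} (hc : 2 ≤ c) :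
    radius d c ^ 2 = ((2 * d : ℕ) : ℝ) * (((2 * d : ℕ) : ℝ) - 1) * (c - 1) *
      Real.log (c / (c - 1)) := by
  have hd : (1 : ℝ) ≤ d := by exact_mod_cast NeZero.pos d
  have hc1 : 0 < c - 1 := by linarith
  have hlog : 0 ≤ Real.log (c / (c - 1)) := Real.log_nonneg (by rw [le_div_iff₀ hc1]; linarith)
  have h1 : (4 * (d : ℝ) ^ 2 - 2 * d) = ((2 * d : ℕ) : ℝ) * (((2 * d : ℕ) : ℝ) - 1) := by
    push_cast; ring
  have h2 : 0 ≤ 4 * (d : ℝ) ^ 2 - 2 * d := by nlinarith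
  rw [radius, Real.sq_sqrt (by positivity), h1]

lemma mem_region_iff (d : ℕ) [NeZero d] {c : ℝ} (hc : 2 ≤ c)
    (X : EuclideanSpace ℝ (Fin (2 * d))) :
    X ∈ region d c ↔ multinomialDensity (2 * d) (∑ i, X i ^ 2) ≤
      hypergeometricDensity (2 * d) c (∑ i, X i ^ 2) ∧ X ∈ hyperplane (2 * d) := by
  rw [multinomialDensity_le_iff (Nat.mul_pos two_pos (NeZero.pos d)) hc, ← radius_sq_eq d hc,
    ← EuclideanSpace.real_norm_sq_eq, region, Set.mem_inter_iff, mem_closedBall_zero_iff,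
    pow_le_pow_iff_left₀ (norm_nonneg X) (show 0 ≤ radius d c from Real.sqrt_nonneg _) two_ne_zero]

lemma hyperplanePoint_mem_hyperplane {m : ℕ} (hm : 0 < m) (y : Fin (m - 1) → ℝ) :
    hyperplanePoint m y ∈ hyperplane m := by
  obtain ⟨p, rfl⟩ := Nat.exists_eq_succ_of_ne_zero hm.ne'
  change ∑ i, hyperplanePoint (p + 1) y i = 0
  rw [Fin.sum_univ_castSucc, hyperplanePoint_last,
    Finset.sum_congr rfl fun i _ => hyperplanePoint_castSucc (p := p) y i]
  exact add_neg_cancel _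

lemma continuous_hyperplanePoint (m : ℕ) : Continuous (hyperplanePoint m) := by
  unfold hyperplanePoint
  refine (PiLp.continuous_toLp 2 _).comp (continuous_pi fun i => ?_)
  split_ifs <;> fun_prop

lemma abs_le_norm_hyperplanePoint {m : ℕ} (y : Fin (m - 1) → ℝ) (j : Fin (m - 1)) :
    |y j| ≤ ‖hyperplanePoint m y‖ := by
  have h := PiLp.norm_apply_le (hyperplanePoint m y) ⟨j, by omega⟩
  simpa [hyperplanePoint] using h

lemma continuous_profile (d : ℕ) (c : ℝ) : Continuous (profile d c) := by
  unfold profile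
  fun_prop

lemma isClosed_region (d : ℕ) (c : ℝ) : IsClosed (region d c) := by
  refine Metric.isClosed_closedBall.inter (isClosed_eq ?_ continuous_const)
  fun_prop

lemma mapsTo_profile_region (d : ℕ) [NeZero d] {c : ℝ} (hc : 2 ≤ c) :
    Set.MapsTo (profile d c) (region d c) (Set.Icc 0 1) := by
  intro X hX
  have h1 := ((mem_region_iff d hc X).1 hX).1
  have h2 := hypergeometricDensity_le_one (m := 2 * d) (q := ∑ i, X i ^ 2)
    (by have := NeZero.pos d; omega) hc (Finset.sum_nonneg fun i _ => sq_nonneg _)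
  have h3 : 0 < multinomialDensity (2 * d) (∑ i, X i ^ 2) := Real.exp_pos _
  rw [profile_eq d hc]
  constructor <;> linarith

lemma integrableOn_profile_region (d : ℕ) (c : ℝ) :
    IntegrableOn (profile d c) (region d c) (hyperplaneMeasure (2 * d)) := by
  have hmeas := (continuous_hyperplanePoint (2 * d)).measurable
  rw [IntegrableOn, hyperplaneMeasure,
    Measure.restrict_map hmeas (isClosed_region d c).measurableSet,
    integrable_map_measure (continuous_profile d c).aestronglyMeasurable hmeas.aemeasurable]
  have hcont := (continuous_profile d c).comp (continuous_hyperplanePoint (2 * d))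
  refine (hcont.continuousOn.integrableOn_compact
    (isCompact_univ_pi fun _ : Fin (2 * d - 1) => isCompact_Icc (a := -radius d c)
      (b := radius d c))).mono_set ?_
  intro y hy j _
  exact abs_le.1 ((abs_le_norm_hyperplanePoint y j).trans (mem_closedBall_zero_iff.1 hy.1))

/-- The region is where the difference of the densities is nonnegative on the hyperplane, so
restricting to it amounts to taking the positive part. -/
lemma setIntegral_profile_region (d : ℕ) [NeZero d] {c : ℝ} (hc : 2 ≤ c) :
    ∫ X in region d c, profile d c X ∂(hyperplaneMeasure (2 * d)) =
      ∫ y, limitProfile (2 * d) c y := by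
  have hmeas := (continuous_hyperplanePoint (2 * d)).measurable
  have hR := (isClosed_region d c).measurableSet
  rw [hyperplaneMeasure, setIntegral_map hR (continuous_profile d c).aestronglyMeasurable
    hmeas.aemeasurable, ← integral_indicator (hmeas hR)]
  refine integral_congr_ae (Filter.Eventually.of_forall fun y => ?_)
  have hy := hyperplanePoint_mem_hyperplane (Nat.mul_pos two_pos (NeZero.pos d)) y
  have hmem := mem_region_iff d hc (hyperplanePoint (2 * d) y)
  by_cases h : y ∈ hyperplanePoint (2 * d) ⁻¹' region d c
  · rw [Set.indicator_of_mem h, profile_eq d hc, limitProfile,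
      max_eq_left (sub_nonneg.2 (hmem.1 h).1)]
  · rw [Set.indicator_of_notMem h, limitProfile, max_eq_right]
    exact sub_nonpos.2 (le_of_not_ge fun h' => h (hmem.2 ⟨h', hy⟩))

end CardDeck

theorem theorem1 (d : ℕ) [NeZero d] (c : ℝ) (hc : 2 * (d : ℝ) ≤ c) :
    (∀ (n K : ℕ) (h : n ≤ 2 * d * K),
      CardDeck.deckDist d n (2 * d * K) h =
        CardDeck.tvDist (CardDeck.hypergeometricMass (fun _ : Fin (2 * d) => K) n)
          (CardDeck.multinomialMass (fun _ : Fin (2 * d) => 1 / (2 * (d : ℝ))) n)) ∧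
    Set.MapsTo (CardDeck.profile d c) (CardDeck.region d c) (Set.Icc 0 1) ∧
    MeasureTheory.IntegrableOn (CardDeck.profile d c) (CardDeck.region d c)
      (CardDeck.hyperplaneMeasure (2 * d)) ∧
    ∃ C : ℝ, 0 < C ∧ ∃ n₀ : ℕ, ∀ n : ℕ, n₀ ≤ n →
      ∀ (K : ℕ) (h : n ≤ 2 * d * K), ((2 * d * K : ℕ) : ℝ) = c * n →
        |CardDeck.deckDist d n (2 * d * K) h -
            ∫ X in CardDeck.region d c, CardDeck.profile d c X
              ∂(CardDeck.hyperplaneMeasure (2 * d))| ≤ C / Real.sqrt n := by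
  have hd : (1 : ℝ) ≤ d := by exact_mod_cast NeZero.pos d
  have hc2 : 2 ≤ c := by linarith
  refine ⟨fun n K h => CardDeck.deckDist_eq_tvDist d n K h, CardDeck.mapsTo_profile_region d hc2,
    CardDeck.integrableOn_profile_region d c, ?_⟩
  -- Stated for a free m so that m = p + 1 can be substituted; 2d itself is not syntactically a
  -- successor.
  have main : ∀ m : ℕ, 0 < m → (m : ℝ) ≤ c → ∃ C W : ℝ, 0 ≤ C ∧ ∀ n K : ℕ, W ≤ Real.sqrt n →
      ((m * K : ℕ) : ℝ) = c * n →
      |CardDeck.tvDist (CardDeck.hypergeometricMass (fun _ : Fin m => K) n)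
          (CardDeck.multinomialMass (fun _ : Fin m => 1 / (m : ℝ)) n) -
        ∫ y, CardDeck.limitProfile m c y| ≤ C / Real.sqrt n := by
    intro m hm hmc
    obtain ⟨p, rfl⟩ := Nat.exists_eq_succ_of_ne_zero hm.ne'
    exact CardDeck.exists_abs_tvDist_sub_integral_le p hc2 hmc
  obtain ⟨C, W, hC, hCW⟩ := main (2 * d) (Nat.mul_pos two_pos (NeZero.pos d))
    (by push_cast; exact hc)
  -- C may be 0, while the implied constant has to be positive.
  refine ⟨C + 1, by linarith, ⌈W ^ 2⌉₊, fun n hn K h hK => ?_⟩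
  rw [CardDeck.deckDist_eq_tvDist, CardDeck.setIntegral_profile_region d hc2]
  have hW : W ≤ Real.sqrt n := Real.le_sqrt_of_sq_le ((Nat.le_ceil _).trans (by exact_mod_cast hn))
  have h1 := hCW n K hW hK
  push_cast at h1
  refine h1.trans ?_
  gcongr
  linarith
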